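/- Write $\mathbb{R}^+=(0,+\infty)$ and let $m$ be the Lebesgue measure on $\mathbb{R}^+$. Let $a_1>a_2>\cdots\ge 0$ be a finite or infinite sequence. If it is finite, its last element is $a_N=0$ and $\mathcal J=\{0,\dots,N-1\}$; if it is infinite, $\lim_n a_n=0$ and $\mathcal J=\mathbb N=\{0,1,2,\dots\}$. Put $I_0=(a_1,+\infty)$ and $I_j=(a_{j+1},a_j)$ for $j\in\mathcal J$, $j\ge1$. Let $T:\mathbb R^+\to\mathbb R^+$ satisfy: (B1) for each $j\in\mathcal J$, $T|_{I_j}$ is a bijection onto $\mathbb R^+$ and has an extension $\tau_j$ which is $C^2$ up to the boundary, defined on $[a_1,+\infty)$ if $j=0$, and on $[a_{j+1},a_j)$ or $(a_{j+1},a_j]$ if $j\ge1$; (B2) there is $\Lambda>1$ such that $|\tau_j'|\ge\Lambda$ for all $j\in\mathcal J$, $j\ge1$; (B3) there is $K>0$ such that $|\tau_j''|/|\tau_j'|^2\le K$ for all $j\in\mathcal J$; (B4) the function $u(x)=x-\tau_0(x)$ on $[a_1,+\infty)$ is positive, convex and tends to $0$ as $x\to+\infty$, and $u''$ is (not necessarily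 strictly) decreasing; (B5) $T$ preserves $m$; (B6) $\tau_j$ is increasing and convex for all $j\in\mathcal J$, $j\ge1$. Then $T$ is global-local mixing of type (GLM2): for every $F\in L^\infty(\mathbb R^+,m;\mathbb C)$ for which the limit $$\overline m(F)=\lim_{a\to+\infty}\frac1a\int_0^a F\,dm$$ exists in $\mathbb C$, and every $g\in L^1(\mathbb R^+,m;\mathbb C)$, $$\lim_{n\to\infty}\int_{\mathbb R^+}(F\circ T^n)\,g\,dm=\overline m(F)\int_{\mathbb R^+}g\,dm .$$ -/

import Mathlib

open Set Filter Topology MeasureTheory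

/-- The open half-line `ℝ⁺ = (0, +∞)`. As a subtype of `ℝ` it carries the Borel σ-algebra. -/
abbrev HalfLine : Type := Ioi (0 : ℝ)

/-- The Lebesgue measure on the half-line. -/
noncomputable def leb : Measure HalfLine := Measure.comap Subtype.val volume

/-- The finite or infinite sequence `a 1 > a 2 > ⋯ ≥ 0` of division points: if there are
`N < ∞` branches, the last point is `a N = 0`; if there are infinitely many, `a n → 0`.
Only the values `a j` with `1 ≤ j ≤ numBranches` matter. -/
structure HalfLinePartition where
  /-- the number of branches, possibly infinite -/
  numBranches : ℕ∞
  /-- the division points -/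
  a : ℕ → ℝ
  one_le : 1 ≤ numBranches
  decreasing : ∀ j : ℕ, 1 ≤ j → ((j + 1 : ℕ) : ℕ∞) ≤ numBranches → a (j + 1) < a j
  last_eq_zero : ∀ n : ℕ, numBranches = (n : ℕ∞) → a n = 0
  tendsto_zero : numBranches = ⊤ → Tendsto a atTop (𝓝 0)

namespace HalfLinePartition

/-- The index set: `{0, …, N - 1}` for `N` branches, all of `ℕ` for infinitely many. -/
def index (P : HalfLinePartition) : Set ℕ := {j | (j : ℕ∞) < P.numBranches}

/-- The open intervals `I_0 = (a 1, +∞)` and `I_j = (a (j+1), a j)` for `j ≥ 1`. -/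
def piece (P : HalfLinePartition) (j : ℕ) : Set ℝ :=
  if j = 0 then Ioi (P.a 1) else Ioo (P.a (j + 1)) (P.a j)

/-- The possible domains of the extended branches: `[a 1, +∞)` for `j = 0`, and one of
`[a (j+1), a j)`, `(a (j+1), a j]` for `j ≥ 1`. -/
def IsBranchDomain (P : HalfLinePartition) (j : ℕ) (D : Set ℝ) : Prop :=
  if j = 0 then D = Ici (P.a 1)
  else D = Ico (P.a (j + 1)) (P.a j) ∨ D = Ioc (P.a (j + 1)) (P.a j)

end HalfLinePartition

/-- Full `C²` branches: for every index `j`, the restriction of `T` to `I_j` is a bijection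
onto `ℝ⁺`, and it has an extension `τ j` to `D j` which is `C²` up to the boundary.
(The values of `T` at the division points are not constrained.) -/
def HasFullBranches (T : HalfLine → HalfLine) (P : HalfLinePartition)
    (τ : ℕ → ℝ → ℝ) (D : ℕ → Set ℝ) : Prop :=
  ∀ j ∈ P.index,
    BijOn T {x : HalfLine | (x : ℝ) ∈ P.piece j} univ ∧
    P.IsBranchDomain j (D j) ∧
    (∀ x : HalfLine, (x : ℝ) ∈ P.piece j → (T x : ℝ) = τ j (x : ℝ)) ∧
    ContDiffOn ℝ 2 (τ j) (D j)

/-- Uniform expansion of all the branches of index `j ≥ 1`. -/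
def IsExpandingOffZeroBranch (P : HalfLinePartition) (τ : ℕ → ℝ → ℝ) (D : ℕ → Set ℝ) : Prop :=
  ∃ Λ : ℝ, 1 < Λ ∧ ∀ j ∈ P.index, 1 ≤ j → ∀ x ∈ D j, Λ ≤ |derivWithin (τ j) (D j) x|

/-- A uniform bound on `|τ_j''| / |τ_j'|²` over all the branches. -/
def HasBoundedDistortionRatio (P : HalfLinePartition) (τ : ℕ → ℝ → ℝ) (D : ℕ → Set ℝ) : Prop :=
  ∃ K : ℝ, 0 < K ∧ ∀ j ∈ P.index, ∀ x ∈ D j,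
    |iteratedDerivWithin 2 (τ j) (D j) x| / |derivWithin (τ j) (D j) x| ^ 2 ≤ K

/-- The indifferent fixed point at `+∞`: the function `u x = x - τ 0 x` on `[a 1, +∞)` is
positive, convex and vanishing at `+∞`, and `u''` is (not necessarily strictly) decreasing. -/
def HasIndifferentFixedPointAtInfty (P : HalfLinePartition) (τ : ℕ → ℝ → ℝ) : Prop :=
  (∀ x ∈ Ici (P.a 1), 0 < x - τ 0 x) ∧
  ConvexOn ℝ (Ici (P.a 1)) (fun x => x - τ 0 x) ∧
  Tendsto (fun x => x - τ 0 x) atTop (𝓝 0) ∧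
  AntitoneOn (iteratedDerivWithin 2 (fun x => x - τ 0 x) (Ici (P.a 1))) (Ici (P.a 1))

/-- All the branches of index `j ≥ 1` are increasing and convex. -/
def HasIncreasingConvexBranches (P : HalfLinePartition) (τ : ℕ → ℝ → ℝ) (D : ℕ → Set ℝ) : Prop :=
  ∀ j ∈ P.index, 1 ≤ j → MonotoneOn (τ j) (D j) ∧ ConvexOn ℝ (D j) (τ j)

/-- `F` has infinite-volume average `L`: the averages of `F` over `(0, a]` tend to `L`,
as `a → +∞`. -/
def HasInfiniteVolumeAverage (F : HalfLine → ℂ) (L : ℂ) : Prop :=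
  Tendsto (fun a : ℝ => (a : ℂ)⁻¹ * ∫ x in {x : HalfLine | (x : ℝ) ≤ a}, F x ∂leb) atTop (𝓝 L)

/-- Global-local mixing of type 2 with respect to Lebesgue measure: for every global
observable `F` (an essentially bounded function which has an infinite-volume average `L`) and
every local observable `g` (an integrable function), `∫ (F ∘ Tⁿ) g → L * ∫ g`. -/
def IsGLM2 (T : HalfLine → HalfLine) : Prop :=
  ∀ (F : HalfLine → ℂ) (L : ℂ), MemLp F ⊤ leb → HasInfiniteVolumeAverage F L →
    ∀ g : HalfLine → ℂ, Integrable g leb →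
      Tendsto (fun n : ℕ => ∫ x : HalfLine, F (T^[n] x) * g x ∂leb) atTop
        (𝓝 (L * ∫ x : HalfLine, g x ∂leb))

/-! Push Lebesgue measure on `(0, b]` forward by `T^n`. Its density `f n` stays antitone and at most
1, with mass `b`, and tends to 0 pointwise; against such flat monotone profiles `F` is averaged to
`L`.

Antitonicity (`exists_antitone_map_density`) amounts to concavity of distribution functions. By
layer cake it suffices that `x ↦ leb ({T ≤ x} ∩ S)` is concave for every initial segment `S`.
Increasing convex branches have concave inverses, and truncation by `S` is a minimum with a
constant. Branch 0 bends the wrong way, but invariance says that all branches together contribute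
exactly `x`, so its term never has to be concave by itself.

Decay (`tendsto_antitone_density_zero`) is an energy argument: `∫ (f n - f (n+1) ∘ T)²` is the drop
in `∫ (f n)²`, hence tends to 0. Just left of `a 1` the image under `T` is huge, where an antitone
density of mass `b` is small, so `f n (a 1)` is small; just right of `a 1` the image is near 0,
which carries the smallness to the whole half-line.

Finally the superlevel sets of `f n` are initial segments, over which `F - L` has small mean once
they are long (`tendsto_integral_smul_antitone`), and the functions `1_(0,b]` determine weak
convergence against `L¹` (`tendsto_integral_mul_zero`). -/

open scoped ENNReal NNReal

/-! ### Lebesgue measure of initial segments -/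

theorem leb_apply (s : Set HalfLine) : leb s = volume (Subtype.val '' s) :=
  comap_subtype_coe_apply measurableSet_Ioi _ s

theorem leb_setOf_le (a : ℝ) : leb {x : HalfLine | (x : ℝ) ≤ a} = ENNReal.ofReal a := by
  have h : (Subtype.val '' {x : HalfLine | (x : ℝ) ≤ a}) = Ioc 0 a := by
    ext x
    simp only [mem_image, mem_ofPred_eq, Subtype.exists, mem_Ioi, exists_and_left, exists_prop,
      mem_Ioc]
    grind
  rw [leb_apply, h, Real.volume_Ioc, sub_zero]

theorem leb_setOf_lt_le_le (a b : ℝ) :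
    leb {x : HalfLine | a < (x : ℝ) ∧ (x : ℝ) ≤ b} ≤ ENNReal.ofReal (b - a) := by
  rw [leb_apply, ← Real.volume_Ioc]
  exact measure_mono (by rintro _ ⟨x, hx, rfl⟩; exact hx)

theorem leb_setOf_lt_le {a : ℝ} (ha : 0 ≤ a) (b : ℝ) :
    leb {x : HalfLine | a < (x : ℝ) ∧ (x : ℝ) ≤ b} = ENNReal.ofReal (b - a) := by
  have h : (Subtype.val '' {x : HalfLine | a < (x : ℝ) ∧ (x : ℝ) ≤ b}) = Ioc a b := by
    ext x
    simp only [mem_image, mem_ofPred_eq, Subtype.exists, mem_Ioi, exists_and_left, exists_prop,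
      mem_Ioc]
    grind
  rw [leb_apply, h, Real.volume_Ioc]

theorem leb_setOf_lt_lt {a : ℝ} (ha : 0 ≤ a) (b : ℝ) :
    leb {x : HalfLine | a < (x : ℝ) ∧ (x : ℝ) < b} = ENNReal.ofReal (b - a) := by
  have h : (Subtype.val '' {x : HalfLine | a < (x : ℝ) ∧ (x : ℝ) < b}) = Ioo a b := by
    ext x
    simp only [mem_image, mem_ofPred_eq, Subtype.exists, mem_Ioi, exists_and_left, exists_prop,
      mem_Ioo]
    grind
  rw [leb_apply, h, Real.volume_Ioo]

theorem leb_countable {s : Set HalfLine} (hs : s.Countable) : leb s = 0 := by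
  rw [leb_apply]
  exact (hs.image _).measure_zero _

instance : SigmaFinite leb := by
  refine ⟨⟨⟨fun n => {x : HalfLine | (x : ℝ) ≤ n}, fun _ => trivial, fun n => ?_, ?_⟩⟩⟩
  · rw [leb_setOf_le]; exact ENNReal.ofReal_lt_top
  · refine eq_univ_of_forall fun x => ?_
    obtain ⟨n, hn⟩ := exists_nat_ge (x : ℝ)
    exact mem_iUnion.2 ⟨n, hn⟩

theorem measurableSet_setOf_coe_le (a : ℝ) : MeasurableSet {x : HalfLine | (x : ℝ) ≤ a} :=
  measurable_subtype_coe measurableSet_Iic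

/-- Lower sets of a linear order are nested, and nested sets of equal finite measure agree almost
everywhere. -/
theorem IsLowerSet.ae_eq_setOf_le {S : Set HalfLine} (hS : IsLowerSet S) (hfin : leb S ≠ ∞) :
    S =ᵐ[leb] {x : HalfLine | (x : ℝ) ≤ (leb S).toReal} := by
  have hI : IsLowerSet {x : HalfLine | (x : ℝ) ≤ (leb S).toReal} :=
    fun x y hxy hx => le_trans (Subtype.coe_le_coe.2 hxy) hx
  have hm : leb {x : HalfLine | (x : ℝ) ≤ (leb S).toReal} = leb S := by
    rw [leb_setOf_le, ENNReal.ofReal_toReal hfin]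
  rcases hS.total hI with h | h
  · exact ae_eq_of_subset_of_measure_ge h hm.le hS.ordConnected.measurableSet.nullMeasurableSet
      (by rw [hm]; exact hfin)
  · exact (ae_eq_of_subset_of_measure_ge h hm.ge
      (measurableSet_setOf_coe_le _).nullMeasurableSet hfin).symm

/-! ### Concave distribution functions and antitone densities -/

theorem concaveOn_toReal {s : Set ℝ} {f : ℝ → ℝ≥0∞} (hf : ConcaveOn ℝ≥0 s f)
    (hfin : ∀ x ∈ s, f x ≠ ∞) (hs : Convex ℝ s) : ConcaveOn ℝ s fun x => (f x).toReal := by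
  refine ⟨hs, fun x hx y hy a b ha hb hab => ?_⟩
  lift a to ℝ≥0 using ha
  lift b to ℝ≥0 using hb
  have hab' : a + b = 1 := by exact_mod_cast hab
  have h := hf.2 hx hy zero_le zero_le hab'
  have hmem := hs hx hy a.2 b.2 hab
  have := ENNReal.toReal_mono (hfin _ hmem) h
  rw [ENNReal.toReal_add, ENNReal.toReal_smul, ENNReal.toReal_smul] at this
  · exact this
  · exact ENNReal.mul_ne_top ENNReal.coe_ne_top (hfin x hx)
  · exact ENNReal.mul_ne_top ENNReal.coe_ne_top (hfin y hy)

theorem lintegral_leb_setOf_le (f : ℝ → ℝ≥0∞) (a : ℝ) :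
    ∫⁻ x in {x : HalfLine | (x : ℝ) ≤ a}, f x ∂leb = ∫⁻ x in Ioc 0 a, f x := by
  rw [← lintegral_indicator (measurableSet_setOf_coe_le a)]
  have h := lintegral_subtype_comap (μ := volume) (measurableSet_Ioi (a := (0 : ℝ)))
    ((Iic a).indicator f)
  rw [lintegral_indicator measurableSet_Iic, Measure.restrict_restrict measurableSet_Iic,
    inter_comm, Ioi_inter_Iic] at h
  exact h

/-- A measure bounded by Lebesgue measure with concave distribution function has an antitone
density. -/
theorem exists_antitone_density (ν : Measure HalfLine) [IsFiniteMeasure ν] (hle : ν ≤ leb)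
    (hconc : ConcaveOn ℝ≥0 (Ioi 0) fun x : ℝ => ν {y | (y : ℝ) ≤ x}) :
    ∃ h : HalfLine → ℝ≥0, Antitone h ∧ (∀ x, h x ≤ 1) ∧
      ν = leb.withDensity fun x => (h x : ℝ≥0∞) := by
  set G : ℝ → ℝ := fun x => (ν {y | (y : ℝ) ≤ x}).toReal with hG
  have hGc : ConcaveOn ℝ (Ioi 0) G :=
    concaveOn_toReal hconc (fun _ _ => measure_ne_top _ _) (convex_Ioi 0)
  have hmono : Monotone G := fun x y hxy =>
    ENNReal.toReal_mono (measure_ne_top _ _) (measure_mono fun z hz => le_trans hz hxy)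
  -- Domination by Lebesgue measure gives the Lipschitz constant 1, hence both the bound on the
  -- density and the continuity of `G` at 0.
  have hlip : LipschitzWith 1 G := by
    refine LipschitzWith.of_le_add fun x y => ?_
    rcases le_total x y with hxy | hxy
    · exact (hmono hxy).trans (le_add_of_nonneg_right dist_nonneg)
    · have h1 : ν {z | (z : ℝ) ≤ x} ≤ ν {z | (z : ℝ) ≤ y} + ENNReal.ofReal (x - y) := by
        calc ν {z | (z : ℝ) ≤ x}
            ≤ ν ({z | (z : ℝ) ≤ y} ∪ {z | y < (z : ℝ) ∧ (z : ℝ) ≤ x}) :=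
              measure_mono fun z hz => by
                rcases le_or_gt (z : ℝ) y with h | h
                · exact Or.inl h
                · exact Or.inr ⟨h, hz⟩
          _ ≤ _ := (measure_union_le _ _).trans
              (add_le_add le_rfl ((hle _).trans (leb_setOf_lt_le_le y x)))
      have h2 := ENNReal.toReal_mono (by finiteness) h1
      rw [ENNReal.toReal_add (by finiteness) (by finiteness),
        ENNReal.toReal_ofReal (sub_nonneg.2 hxy)] at h2
      rwa [Real.dist_eq, abs_of_nonneg (sub_nonneg.2 hxy)]
  -- A concave function has a right derivative at every interior point, so this choice is antitone
  -- on all of `Ioi 0`, not just almost everywhere.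
  set d : ℝ → ℝ := fun x => derivWithin G (Ioi x) x with hd
  have hd0 : ∀ x, 0 ≤ d x := fun x => (hmono.monotoneOn _).derivWithin_nonneg
  have hd1 : ∀ x, d x ≤ 1 := fun x => by
    by_cases hx : DifferentiableWithinAt ℝ G (Ioi x) x
    · have hmono' : Monotone fun y => y - G y := fun y z hyz => by
        have := (le_abs_self _).trans (hlip.dist_le_mul z y)
        rw [Real.dist_eq, abs_of_nonneg (sub_nonneg.2 hyz), NNReal.coe_one, one_mul] at this
        linarith
      have h1 := (hasDerivWithinAt_id x (Ioi x)).fun_sub hx.hasDerivWithinAt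
      have h2 := (hmono'.monotoneOn (Ioi x)).derivWithin_nonneg (x := x)
      have h3 := h1.derivWithin (uniqueDiffWithinAt_Ioi x)
      simp only [id] at h3
      rw [h3] at h2
      exact sub_nonneg.1 h2
    · rw [hd]
      simp only
      rw [derivWithin_zero_of_not_differentiableWithinAt hx]
      exact zero_le_one
  have hdm : Measurable d := measurable_derivWithin_Ioi G
  have hanti : AntitoneOn d (Ioi 0) := by
    have := (neg_convexOn_iff.2 hGc).monotoneOn_rightDeriv
    rw [interior_Ioi] at this
    intro x hx y hy hxy
    have := this hx hy hxy
    simpa [hd, derivWithin.neg] using this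
  have hG0 : ∀ x ≤ 0, G x = 0 := fun x hx => by
    have : {y : HalfLine | (y : ℝ) ≤ x} = ∅ := by
      ext y; simpa using hx.trans_lt y.2
    simp [hG, this]
  have hint : ∀ x, IntervalIntegrable d volume 0 x := fun x =>
    (intervalIntegrable_const (c := (1 : ℝ))).mono_fun hdm.aestronglyMeasurable
      (ae_of_all _ fun y => by simpa [abs_of_nonneg (hd0 y)] using hd1 y)
  have hFTC : ∀ x, 0 < x → ∫ y in (0 : ℝ)..x, d y = G x := fun x hx => by
    rw [intervalIntegral.integral_eq_sub_of_hasDeriv_right_of_le hx.le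
      hlip.continuous.continuousOn (fun y hy => ?_) (hint x), hG0 0 le_rfl, sub_zero]
    have := (neg_convexOn_iff.2 hGc).hasDerivWithinAt_rightDeriv_of_mem_interior
      (x := y) (by rw [interior_Ioi]; exact hy.1)
    simpa [hd] using (this.differentiableWithinAt.neg).hasDerivWithinAt
  refine ⟨fun x => (d x).toNNReal, fun x y hxy => Real.toNNReal_mono (hanti x.2 y.2 hxy),
    fun x => by simpa using hd1 x, ?_⟩
  refine Measure.ext_of_Iic _ _ fun a => ?_
  have hIic : Iic a = {x : HalfLine | (x : ℝ) ≤ (a : ℝ)} := rfl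
  rw [hIic, withDensity_apply _ (measurableSet_setOf_coe_le _),
    lintegral_leb_setOf_le (fun x => ((d x).toNNReal : ℝ≥0∞))]
  have h1 : ν {x : HalfLine | (x : ℝ) ≤ (a : ℝ)} = ENNReal.ofReal (G a) :=
    (ENNReal.ofReal_toReal (measure_ne_top _ _)).symm
  rw [h1, ← hFTC a a.2, intervalIntegral.integral_of_le (le_of_lt a.2),
    ofReal_integral_eq_lintegral_ofReal ((intervalIntegrable_iff_integrableOn_Ioc_of_le
      (le_of_lt a.2)).1 (hint a)) (ae_of_all _ hd0)]
  rfl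

theorem concaveOn_tsum {ι : Type*} {s : Set ℝ} (hs : Convex ℝ≥0 s) {f : ι → ℝ → ℝ≥0∞}
    (hf : ∀ i, ConcaveOn ℝ≥0 s (f i)) : ConcaveOn ℝ≥0 s fun x => ∑' i, f i x := by
  refine ⟨hs, fun x hx y hy a b ha hb hab => ?_⟩
  simp only [ENNReal.smul_def, smul_eq_mul, ← ENNReal.tsum_mul_left, ← ENNReal.tsum_add]
  exact ENNReal.tsum_le_tsum fun i => (hf i).2 hx hy ha hb hab

theorem concaveOn_lintegral {α : Type*} [MeasurableSpace α] {μ : Measure α} {s : Set ℝ}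
    (hs : Convex ℝ≥0 s) {f : α → ℝ → ℝ≥0∞} (hm : ∀ x, Measurable fun t => f t x)
    (hf : ∀ t, ConcaveOn ℝ≥0 s (f t)) : ConcaveOn ℝ≥0 s fun x => ∫⁻ t, f t x ∂μ := by
  refine ⟨hs, fun x hx y hy a b ha hb hab => ?_⟩
  simp only [ENNReal.smul_def, smul_eq_mul]
  rw [← lintegral_const_mul _ (hm x), ← lintegral_const_mul _ (hm y),
    ← lintegral_add_left ((hm x).const_mul _)]
  exact lintegral_mono fun t => (hf t).2 hx hy ha hb hab

theorem concaveOn_inf {s : Set ℝ} {f g : ℝ → ℝ≥0∞}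
    (hf : ConcaveOn ℝ≥0 s f) (hg : ConcaveOn ℝ≥0 s g) :
    ConcaveOn ℝ≥0 s fun x => min (f x) (g x) := by
  refine ⟨hf.1, fun x hx y hy a b ha hb hab => ?_⟩
  have h1 := hf.2 hx hy ha hb hab
  have h2 := hg.2 hx hy ha hb hab
  simp only [ENNReal.smul_def, smul_eq_mul] at h1 h2 ⊢
  refine le_min (le_trans ?_ h1) (le_trans ?_ h2) <;> gcongr
  exacts [min_le_left _ _, min_le_left _ _, min_le_right _ _, min_le_right _ _]

theorem convex_nnreal_Ioi : Convex ℝ≥0 (Ioi (0 : ℝ)) :=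
  fun _ hx _ hy a b _ _ hab => convex_Ioi (𝕜 := ℝ) 0 hx hy a.2 b.2 (by exact_mod_cast hab)

theorem concaveOn_ennreal_ofReal : ConcaveOn ℝ≥0 (Ioi 0) ENNReal.ofReal := by
  refine ⟨convex_nnreal_Ioi, fun x hx y hy a b ha hb hab => ?_⟩
  rw [NNReal.smul_def, NNReal.smul_def, smul_eq_mul, smul_eq_mul,
    ENNReal.ofReal_add (mul_nonneg a.coe_nonneg (le_of_lt hx))
      (mul_nonneg b.coe_nonneg (le_of_lt hy)),
    ENNReal.ofReal_mul a.coe_nonneg, ENNReal.ofReal_mul b.coe_nonneg, ENNReal.ofReal_coe_nnreal,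
    ENNReal.ofReal_coe_nnreal]
  rfl

theorem concaveOn_add_const {s : Set ℝ} {f : ℝ → ℝ≥0∞} (hf : ConcaveOn ℝ≥0 s f) (c : ℝ≥0∞) :
    ConcaveOn ℝ≥0 s fun x => f x + c := by
  refine ⟨hf.1, fun x hx y hy a b ha hb hab => ?_⟩
  have h1 := hf.2 hx hy ha hb hab
  have hab' : (a : ℝ≥0∞) + b = 1 := by exact_mod_cast hab
  simp only [ENNReal.smul_def, smul_eq_mul] at h1 ⊢
  calc (a : ℝ≥0∞) * (f x + c) + b * (f y + c) = (a * f x + b * f y) + (a + b) * c := by ring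
    _ ≤ _ := by rw [hab', one_mul]; gcongr

/-! ### The pieces of the partition -/

namespace HalfLinePartition

variable (P : HalfLinePartition)

/-- The `j`-th piece as a subset of the half-line. -/
def halfPiece (j : ℕ) : Set HalfLine := {x | (x : ℝ) ∈ P.piece j}

variable {P}

theorem a_le_a {i j : ℕ} (hi : 1 ≤ i) (hij : i ≤ j) (hj : (j : ℕ∞) ≤ P.numBranches) :
    P.a j ≤ P.a i := by
  induction j, hij using Nat.le_induction with
  | base => exact le_rfl
  | succ k hk ih =>
    have hk' : (k : ℕ∞) ≤ P.numBranches := le_trans (by exact_mod_cast k.le_succ) hj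
    exact (P.decreasing k (hi.trans hk) hj).le.trans (ih hk')

theorem a_nonneg {j : ℕ} (hj1 : 1 ≤ j) (hj : (j : ℕ∞) ≤ P.numBranches) : 0 ≤ P.a j := by
  rcases eq_or_ne P.numBranches ⊤ with h | h
  · refine le_of_tendsto (P.tendsto_zero h) ?_
    filter_upwards [eventually_ge_atTop j] with k hk
    exact a_le_a hj1 hk (by simp [h])
  · lift P.numBranches to ℕ using h with n hn
    rw [← P.last_eq_zero n hn.symm]
    exact a_le_a hj1 (by exact_mod_cast hj) (by rw [← hn])

theorem succ_le_of_mem_index {j : ℕ} (hj : j ∈ P.index) : ((j + 1 : ℕ) : ℕ∞) ≤ P.numBranches := by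
  have : (j : ℕ∞) < P.numBranches := hj
  push_cast
  exact Order.add_one_le_of_lt this

theorem exists_mem_halfPiece (x : HalfLine) (hx : ∀ j, (x : ℝ) ≠ P.a j) :
    ∃ j ∈ P.index, x ∈ P.halfPiece j := by
  rcases lt_or_ge (P.a 1) (x : ℝ) with h1 | h1
  · exact ⟨0, lt_of_lt_of_le (by norm_num) P.one_le, by simpa [halfPiece, piece] using h1⟩
  have hex : ∃ k : ℕ, 1 ≤ k ∧ (k : ℕ∞) ≤ P.numBranches ∧ P.a k < x := by
    rcases eq_or_ne P.numBranches ⊤ with h | h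
    · obtain ⟨k, hk1, hk⟩ := ((eventually_ge_atTop 1).and
        ((P.tendsto_zero h).eventually (gt_mem_nhds x.2))).exists
      exact ⟨k, hk1, by simp [h], hk⟩
    · obtain ⟨n, hn⟩ := ENat.ne_top_iff_exists.1 h
      refine ⟨n, ?_, hn.le, ?_⟩
      · have := P.one_le
        rw [← hn] at this
        exact_mod_cast this
      · rw [P.last_eq_zero n hn.symm]; exact x.2
  classical
  -- The least `k` with `a k < x` is some `j + 1`, and minimality puts `x` below `a j`.
  obtain ⟨hk1, hkN, hkx⟩ := Nat.find_spec hex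
  have hmin := fun m => Nat.find_min hex (m := m)
  set k := Nat.find hex
  have hk2 : k ≠ 1 := fun h => by rw [h] at hkx; exact absurd hkx (not_lt.2 h1)
  obtain ⟨j, hj⟩ : ∃ j, k = j + 1 := ⟨k - 1, by omega⟩
  rw [hj] at hkN hkx
  have hj0 : j ≠ 0 := by omega
  have hjN : (j : ℕ∞) < P.numBranches := lt_of_lt_of_le (by exact_mod_cast j.lt_succ_self) hkN
  have hjx : (x : ℝ) < P.a j := by
    refine lt_of_le_of_ne (not_lt.1 fun h => hmin j (by omega) ⟨by omega, hjN.le, h⟩) (hx j)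
  exact ⟨j, hjN, by simp only [halfPiece, piece, hj0, if_false]; exact ⟨hkx, hjx⟩⟩

theorem lt_of_mem_halfPiece {j : ℕ} (hj : 1 ≤ j) {x : HalfLine} (hx : x ∈ P.halfPiece j) :
    (x : ℝ) < P.a j := by
  have hj0 : j ≠ 0 := by omega
  simp only [halfPiece, piece, hj0, if_false] at hx
  exact hx.2

theorem a_succ_lt_of_mem_halfPiece {j : ℕ} {x : HalfLine} (hx : x ∈ P.halfPiece j) :
    P.a (j + 1) < (x : ℝ) := by
  rcases eq_or_ne j 0 with rfl | hj0
  · simpa [halfPiece, piece] using hx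
  · simp only [halfPiece, piece, hj0, if_false] at hx
    exact hx.1

theorem disjoint_halfPiece_of_lt {i j : ℕ} (hj : j ∈ P.index) (hij : i < j) :
    Disjoint (P.halfPiece i) (P.halfPiece j) := by
  refine disjoint_left.2 fun x hxi hxj => ?_
  have h1 := lt_of_mem_halfPiece (by omega) hxj
  have h2 := a_succ_lt_of_mem_halfPiece hxi
  have h3 : P.a j ≤ P.a (i + 1) := a_le_a (by omega) hij (le_of_lt hj)
  linarith

theorem measurableSet_halfPiece (j : ℕ) : MeasurableSet (P.halfPiece j) := by
  refine measurable_subtype_coe (?_ : MeasurableSet (P.piece j))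
  unfold piece
  split_ifs
  exacts [measurableSet_Ioi, measurableSet_Ioo]

theorem leb_eq_tsum_inter_halfPiece {B : Set HalfLine} (hB : MeasurableSet B) :
    leb B = ∑' j : P.index, leb (B ∩ P.halfPiece j) := by
  rw [← measure_iUnion]
  · refine le_antisymm ?_ (measure_mono (iUnion_subset fun j => inter_subset_left))
    have hnull : leb {x : HalfLine | ∃ j, (x : ℝ) = P.a j} = 0 := by
      refine leb_countable ?_
      have : {x : HalfLine | ∃ j, (x : ℝ) = P.a j} = Subtype.val ⁻¹' range P.a := by
        ext x; simp [eq_comm]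
      rw [this]
      exact (countable_range P.a).preimage Subtype.val_injective
    calc leb B ≤ leb ((⋃ j : P.index, B ∩ P.halfPiece j) ∪ {x : HalfLine | ∃ j, (x : ℝ) = P.a j}) :=
          measure_mono fun x hx => by
            by_cases h : ∃ j, (x : ℝ) = P.a j
            · exact Or.inr h
            · push Not at h
              obtain ⟨j, hj, hxj⟩ := exists_mem_halfPiece x h
              exact Or.inl (mem_iUnion.2 ⟨⟨j, hj⟩, hx, hxj⟩)
      _ ≤ _ := (measure_union_le _ _).trans (by rw [hnull, add_zero])
  · intro i j hij
    have hne : (i : ℕ) ≠ j := fun h => hij (Subtype.ext h)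
    refine Disjoint.mono inter_subset_right inter_subset_right ?_
    rcases lt_or_gt_of_ne hne with h | h
    · exact disjoint_halfPiece_of_lt j.2 h
    · exact (disjoint_halfPiece_of_lt i.2 h).symm
  · exact fun j => hB.inter (measurableSet_halfPiece _)

theorem IsBranchDomain.piece_subset {j : ℕ} {D : Set ℝ} (h : P.IsBranchDomain j D) :
    P.piece j ⊆ D := by
  unfold IsBranchDomain at h
  unfold piece
  split_ifs at h ⊢
  · rw [h]; exact Ioi_subset_Ici_self
  · rcases h with h | h <;> rw [h]
    exacts [Ioo_subset_Ico_self, Ioo_subset_Ioc_self]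

theorem convex_piece (j : ℕ) : Convex ℝ (P.piece j) := by
  unfold piece
  split_ifs
  exacts [convex_Ioi _, convex_Ioo _ _]

end HalfLinePartition

open HalfLinePartition

/-! ### The transfer operator preserves antitone densities -/

section Branches

variable {T : HalfLine → HalfLine} {P : HalfLinePartition} {τ : ℕ → ℝ → ℝ} {D : ℕ → Set ℝ}

/-- A convex function that rises once, to a value at `y`, never falls below that value later; as the
value is positive, this contradicts the limit 0. -/
theorem HasIndifferentFixedPointAtInfty.antitoneOn (h : HasIndifferentFixedPointAtInfty P τ) :
    AntitoneOn (fun x => x - τ 0 x) (Ici (P.a 1)) := by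
  obtain ⟨hpos, hconv, hlim, -⟩ := h
  intro x hx y hy hxy
  by_contra! hlt
  have hne : x < y := lt_of_le_of_ne hxy (by rintro rfl; exact lt_irrefl _ hlt)
  have hev : ∀ᶠ z in atTop, y - τ 0 y ≤ z - τ 0 z := by
    filter_upwards [eventually_gt_atTop y] with z hz
    exact hconv.le_right_of_left_le hx (le_trans hy hz.le : P.a 1 ≤ z)
      (by rw [openSegment_eq_Ioo (hne.trans hz)]; exact ⟨hne, hz⟩) hlt.le
  have := ge_of_tendsto hlim hev
  exact absurd (hpos y hy) (not_lt.2 this)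

theorem HasFullBranches.strictMonoOn (hfull : HasFullBranches T P τ D)
    (hindiff : HasIndifferentFixedPointAtInfty P τ) (hconv : HasIncreasingConvexBranches P τ D)
    {j : ℕ} (hj : j ∈ P.index) : StrictMonoOn T (P.halfPiece j) := by
  obtain ⟨hbij, hD, hT, -⟩ := hfull j hj
  rcases Nat.eq_zero_or_pos j with rfl | hj1
  · intro x hx y hy hxy
    rw [← Subtype.coe_lt_coe, hT x hx, hT y hy]
    have hx' : P.a 1 ≤ x := (a_succ_lt_of_mem_halfPiece hx).le
    have hy' : P.a 1 ≤ y := (a_succ_lt_of_mem_halfPiece hy).le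
    have := hindiff.antitoneOn hx' hy' (Subtype.coe_le_coe.2 hxy.le)
    have hxy' : (x : ℝ) < y := hxy
    simp only at this
    linarith
  · refine MonotoneOn.strictMonoOn_of_injOn ?_ hbij.injOn
    intro x hx y hy hxy
    rw [← Subtype.coe_le_coe, hT x hx, hT y hy]
    exact (hconv j hj hj1).1 (hD.piece_subset hx) (hD.piece_subset hy) hxy

/-- The measure is the inverse branch at `x` minus `a (j + 1)`, and the inverse of an increasing
convex function is concave. -/
theorem concaveOn_leb_branch (hfull : HasFullBranches T P τ D)
    (hindiff : HasIndifferentFixedPointAtInfty P τ) (hconv : HasIncreasingConvexBranches P τ D)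
    {j : ℕ} (hj : j ∈ P.index) (hj1 : 1 ≤ j) :
    ConcaveOn ℝ≥0 (Ioi 0) fun x : ℝ => leb ({y | (T y : ℝ) ≤ x} ∩ P.halfPiece j) := by
  have hmono := hfull.strictMonoOn hindiff hconv hj
  obtain ⟨hbij, hD, hT, -⟩ := hfull j hj
  have hj0 : j ≠ 0 := by omega
  have ha : 0 ≤ P.a (j + 1) := a_nonneg (by omega) (succ_le_of_mem_index hj)
  have hset : ∀ z ∈ P.halfPiece j, ∀ x : ℝ, x = T z → {y | (T y : ℝ) ≤ x} ∩ P.halfPiece j =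
      {y : HalfLine | P.a (j + 1) < (y : ℝ) ∧ (y : ℝ) ≤ z} := by
    rintro z hz x rfl
    ext y
    constructor
    · rintro ⟨h1, h2⟩
      exact ⟨a_succ_lt_of_mem_halfPiece h2, (hmono.le_iff_le h2 hz).1 h1⟩
    · rintro ⟨h1, h2⟩
      have hy : y ∈ P.halfPiece j := by
        simp only [halfPiece, piece, hj0, if_false]
        exact ⟨h1, h2.trans_lt (lt_of_mem_halfPiece hj1 hz)⟩
      exact ⟨(hmono.le_iff_le hy hz).2 h2, hy⟩
  refine ⟨convex_nnreal_Ioi, fun x hx y hy a b ha' hb' hab => ?_⟩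
  have hab' : (a : ℝ) + b = 1 := by exact_mod_cast hab
  obtain ⟨p, hp, hpx⟩ := hbij.surjOn (mem_univ (⟨x, hx⟩ : HalfLine))
  obtain ⟨q, hq, hqy⟩ := hbij.surjOn (mem_univ (⟨y, hy⟩ : HalfLine))
  have hpx' : x = T p := by rw [hpx]
  have hqy' : y = T q := by rw [hqy]
  set z : ℝ := a • (p : ℝ) + b • (q : ℝ) with hz
  have hzmem : z ∈ P.piece j := convex_piece j hp hq a.2 b.2 hab'
  have hz0 : 0 < z := ha.trans_lt (by
    simp only [piece, hj0, if_false] at hzmem; exact hzmem.1)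
  have hTz : (T ⟨z, hz0⟩ : ℝ) ≤ a • x + b • y := by
    rw [hT ⟨z, hz0⟩ hzmem, hpx', hqy', hT p hp, hT q hq]
    exact (hconv j hj hj1).2.2 (hD.piece_subset hp) (hD.piece_subset hq) a.2 b.2 hab'
  calc a • leb ({y | (T y : ℝ) ≤ x} ∩ P.halfPiece j) + b • leb ({z | (T z : ℝ) ≤ y} ∩ P.halfPiece j)
      = a • ENNReal.ofReal (p - P.a (j + 1)) + b • ENNReal.ofReal (q - P.a (j + 1)) := by
        rw [hset p hp x hpx', hset q hq y hqy', leb_setOf_lt_le ha, leb_setOf_lt_le ha]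
    _ ≤ ENNReal.ofReal (z - P.a (j + 1)) := by
        have h := concaveOn_ennreal_ofReal.2
          (sub_pos.2 (a_succ_lt_of_mem_halfPiece hp)) (sub_pos.2 (a_succ_lt_of_mem_halfPiece hq))
          ha' hb' hab
        refine h.trans_eq (congrArg _ ?_)
        simp only [hz, NNReal.smul_def, smul_eq_mul]
        linear_combination (-P.a (j + 1)) * hab'
    _ = leb ({y | (T y : ℝ) ≤ T ⟨z, hz0⟩} ∩ P.halfPiece j) := by
        rw [hset ⟨z, hz0⟩ hzmem _ rfl, leb_setOf_lt_le ha]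
    _ ≤ _ := measure_mono (inter_subset_inter_left _ fun w hw => le_trans hw hTz)

/-- Since `T` is monotone on the piece, both sets cut it in an initial segment, and of two such
segments one contains the other. -/
theorem leb_inter_lowerSet_inter_branch (hfull : HasFullBranches T P τ D)
    (hindiff : HasIndifferentFixedPointAtInfty P τ) (hconv : HasIncreasingConvexBranches P τ D)
    {j : ℕ} (hj : j ∈ P.index) {S : Set HalfLine} (hS : IsLowerSet S) (x : ℝ) :
    leb ({y | (T y : ℝ) ≤ x} ∩ S ∩ P.halfPiece j) =
      min (leb ({y | (T y : ℝ) ≤ x} ∩ P.halfPiece j)) (leb (S ∩ P.halfPiece j)) := by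
  have hmono := (hfull.strictMonoOn hindiff hconv hj).monotoneOn
  rw [inter_inter_distrib_right]
  by_cases h : {y | (T y : ℝ) ≤ x} ∩ P.halfPiece j ⊆ S ∩ P.halfPiece j
  · rw [inter_eq_left.2 h, min_eq_left (measure_mono h)]
  · have h' : S ∩ P.halfPiece j ⊆ {y | (T y : ℝ) ≤ x} ∩ P.halfPiece j := by
      obtain ⟨p, ⟨hpx, hpj⟩, hpS⟩ := not_subset.1 h
      rintro q ⟨hqS, hqj⟩
      have hqp : q ≤ p := le_of_lt (not_le.1 fun hpq => hpS ⟨hS hpq hqS, hpj⟩)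
      exact ⟨le_trans (Subtype.coe_le_coe.2 (hmono hqj hpj hqp)) hpx, hqj⟩
    rw [inter_eq_right.2 h', min_eq_right (measure_mono h')]

theorem halfPiece_zero : P.halfPiece 0 = {y : HalfLine | (y : ℝ) ≤ P.a 1}ᶜ := by
  ext y; simp [halfPiece, piece]

theorem zero_mem_index : 0 ∈ P.index := lt_of_lt_of_le (by norm_num) P.one_le

/-- If `S` stays left of `a 1`, only the convex branches contribute. Otherwise `S` contains
everything up to `a 1`, and the truncation of branch 0 is rewritten by invariance. -/
theorem concaveOn_leb_preimage_inter_lowerSet (hfull : HasFullBranches T P τ D)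
    (hindiff : HasIndifferentFixedPointAtInfty P τ) (hpres : MeasurePreserving T leb leb)
    (hconv : HasIncreasingConvexBranches P τ D) {S : Set HalfLine} (hS : IsLowerSet S) :
    ConcaveOn ℝ≥0 (Ioi 0) fun x : ℝ => leb ({y | (T y : ℝ) ≤ x} ∩ S) := by
  have hTm : ∀ x : ℝ, MeasurableSet {y | (T y : ℝ) ≤ x} := fun x =>
    hpres.measurable (measurableSet_setOf_coe_le x)
  have hlow : ∀ {S : Set HalfLine}, IsLowerSet S → S ⊆ {y | (y : ℝ) ≤ P.a 1} →
      ConcaveOn ℝ≥0 (Ioi 0) fun x : ℝ => leb ({y | (T y : ℝ) ≤ x} ∩ S) := by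
    intro S hS hsub
    have : (fun x : ℝ => leb ({y | (T y : ℝ) ≤ x} ∩ S)) = fun x : ℝ => ∑' j : P.index,
        min (leb ({y | (T y : ℝ) ≤ x} ∩ P.halfPiece j)) (leb (S ∩ P.halfPiece j)) := by
      ext x
      rw [leb_eq_tsum_inter_halfPiece (P := P) ((hTm x).inter hS.ordConnected.measurableSet)]
      exact tsum_congr fun j => leb_inter_lowerSet_inter_branch hfull hindiff hconv j.2 hS x
    rw [this]
    refine concaveOn_tsum convex_nnreal_Ioi fun j => ?_
    rcases Nat.eq_zero_or_pos (j : ℕ) with h0 | h1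
    · have : S ∩ P.halfPiece j = ∅ := by
        rw [h0, halfPiece_zero, ← sdiff_eq, sdiff_eq_empty.2 hsub]
      simp only [this, measure_empty, min_zero]
      exact concaveOn_const _ convex_nnreal_Ioi
    · exact concaveOn_inf (concaveOn_leb_branch hfull hindiff hconv j.2 h1)
        (concaveOn_const _ convex_nnreal_Ioi)
  have hS1 : IsLowerSet {y : HalfLine | (y : ℝ) ≤ P.a 1} :=
    fun x y hxy hx => le_trans (Subtype.coe_le_coe.2 hxy) hx
  rcases hS.total hS1 with h | h
  · exact hlow hS h
  -- Adding the contribution of `(0, a 1]` inside the minimum turns the full branch-0 term into `leb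
  -- {T ≤ x} = x`, which is linear; the other entry is concave plus a constant.
  · have hsplit : ∀ x : ℝ, leb ({y | (T y : ℝ) ≤ x} ∩ S) = min (ENNReal.ofReal x)
        (leb ({y | (T y : ℝ) ≤ x} ∩ {y : HalfLine | (y : ℝ) ≤ P.a 1}) +
          leb (S ∩ P.halfPiece 0)) := by
      intro x
      have h1 : ENNReal.ofReal x =
          leb ({y | (T y : ℝ) ≤ x} ∩ {y : HalfLine | (y : ℝ) ≤ P.a 1}) +
            leb ({y | (T y : ℝ) ≤ x} ∩ P.halfPiece 0) := by
        rw [halfPiece_zero, ← sdiff_eq, measure_inter_add_sdiff _ (measurableSet_setOf_coe_le _),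
          ← leb_setOf_le, ← hpres.measure_preimage
            (measurableSet_setOf_coe_le x).nullMeasurableSet]
        rfl
      have h2 : leb ({y | (T y : ℝ) ≤ x} ∩ S) =
          leb ({y | (T y : ℝ) ≤ x} ∩ {y : HalfLine | (y : ℝ) ≤ P.a 1}) +
            leb ({y | (T y : ℝ) ≤ x} ∩ S ∩ P.halfPiece 0) := by
        rw [halfPiece_zero, ← sdiff_eq,
          ← measure_inter_add_sdiff ({y | (T y : ℝ) ≤ x} ∩ S) (measurableSet_setOf_coe_le (P.a 1)),
          inter_assoc, inter_eq_right.2 h]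
      rw [h1, h2, leb_inter_lowerSet_inter_branch hfull hindiff hconv zero_mem_index hS,
        min_add_add_left]
    simp only [hsplit]
    exact concaveOn_inf concaveOn_ennreal_ofReal (concaveOn_add_const (hlow hS1 subset_rfl) _)

/-- The transfer operator of `T` maps antitone densities to antitone densities. -/
theorem exists_antitone_map_density (hfull : HasFullBranches T P τ D)
    (hindiff : HasIndifferentFixedPointAtInfty P τ) (hpres : MeasurePreserving T leb leb)
    (hconv : HasIncreasingConvexBranches P τ D) {f : HalfLine → ℝ≥0} (hf : Antitone f)
    (hf1 : ∀ x, f x ≤ 1) (hfin : ∫⁻ x, f x ∂leb ≠ ∞) :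
    ∃ h : HalfLine → ℝ≥0, Antitone h ∧ (∀ x, h x ≤ 1) ∧
      (leb.withDensity fun x => (f x : ℝ≥0∞)).map T = leb.withDensity fun x => (h x : ℝ≥0∞) := by
  have hfm : Measurable f := hf.measurable
  have hTm : ∀ x : ℝ, MeasurableSet {y | (T y : ℝ) ≤ x} := fun x =>
    hpres.measurable (measurableSet_setOf_coe_le x)
  have := isFiniteMeasure_withDensity hfin
  refine exists_antitone_density _ ?_ ?_
  · have h1 : (leb.withDensity fun x => (f x : ℝ≥0∞)) ≤ leb := by
      conv_rhs => rw [← withDensity_one (μ := leb)]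
      exact withDensity_mono (ae_of_all _ fun x => by simpa using hf1 x)
    calc _ ≤ leb.map T := Measure.map_mono h1 hpres.measurable
      _ = leb := hpres.map_eq
  -- Layer cake: the distribution function is a mixture over `t` of those for the lower sets `{t <
  -- f}`.
  · have : ∀ x : ℝ, (leb.withDensity fun x => (f x : ℝ≥0∞)).map T {y | (y : ℝ) ≤ x} =
        ∫⁻ t in Ioi (0 : ℝ), leb ({y | (T y : ℝ) ≤ x} ∩ {y | t < f y}) := by
      intro x
      rw [Measure.map_apply hpres.measurable (measurableSet_setOf_coe_le x),
        withDensity_apply _ (hpres.measurable (measurableSet_setOf_coe_le x))]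
      have h := lintegral_eq_lintegral_meas_lt (leb.restrict {y | (T y : ℝ) ≤ x})
        (f := fun y => (f y : ℝ)) (ae_of_all _ fun y => (f y).2)
        hfm.coe_nnreal_real.aemeasurable
      simp only [ENNReal.ofReal_coe_nnreal] at h
      refine h.trans (lintegral_congr fun t => ?_)
      rw [Measure.restrict_apply (measurableSet_lt measurable_const hfm.coe_nnreal_real),
        inter_comm]
    simp only [this]
    refine concaveOn_lintegral convex_nnreal_Ioi (fun x => ?_) fun t => ?_
    · exact Antitone.measurable fun s t hst => measure_mono
        (inter_subset_inter_right _ fun y hy => lt_of_le_of_lt hst hy)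
    · refine concaveOn_leb_preimage_inter_lowerSet hfull hindiff hpres hconv fun x y hxy hx => ?_
      exact lt_of_lt_of_le hx (NNReal.coe_le_coe.2 (hf hxy))

end Branches

/-! ### Energy dissipation -/

section Energy

variable {X : Type*} [MeasurableSpace X] {μ : Measure X} {T : X → X}

theorem integral_comp_smul_of_map_withDensity {E : Type*} [NormedAddCommGroup E] [NormedSpace ℝ E]
    (hT : Measurable T) {f h : X → ℝ≥0} (hf : Measurable f) (hh : Measurable h)
    (hmap : (μ.withDensity fun x => (f x : ℝ≥0∞)).map T = μ.withDensity fun x => (h x : ℝ≥0∞))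
    {k : X → E} (hk : AEStronglyMeasurable k μ) :
    ∫ x, f x • k (T x) ∂μ = ∫ x, h x • k x ∂μ := by
  rw [← integral_withDensity_eq_integral_smul hf, ← integral_withDensity_eq_integral_smul hh,
    ← hmap, integral_map hT.aemeasurable]
  rw [hmap]
  exact hk.mono_ac (withDensity_absolutelyContinuous _ _)

theorem integrable_coe_nnreal {f : X → ℝ≥0} (hf : Measurable f) (hfin : ∫⁻ x, f x ∂μ ≠ ∞) :
    Integrable (fun x => (f x : ℝ)) μ := by
  refine ⟨hf.coe_nnreal_real.aestronglyMeasurable, ?_⟩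
  simpa [HasFiniteIntegral] using hfin.lt_top

/-- For a bounded sequence of densities pushed forward by a measure preserving map, consecutive
terms are asymptotically related by composition, in the `L²` sense. -/
theorem tendsto_integral_sq_sub_comp (hT : MeasurePreserving T μ μ) {f : ℕ → X → ℝ≥0}
    (hf : ∀ n, Measurable (f n)) (hf1 : ∀ n x, f n x ≤ 1) (hfin : ∀ n, ∫⁻ x, f n x ∂μ ≠ ∞)
    (hmap : ∀ n, (μ.withDensity fun x => (f n x : ℝ≥0∞)).map T =
      μ.withDensity fun x => (f (n + 1) x : ℝ≥0∞)) :
    (∀ n, Integrable (fun x => ((f n x : ℝ) - f (n + 1) (T x)) ^ 2) μ) ∧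
    Tendsto (fun n => ∫ x, ((f n x : ℝ) - f (n + 1) (T x)) ^ 2 ∂μ) atTop (𝓝 0) := by
  have hi : ∀ n, Integrable (fun x => (f n x : ℝ)) μ := fun n =>
    integrable_coe_nnreal (hf n) (hfin n)
  have hb : ∀ n x, ‖(f n x : ℝ)‖ ≤ 1 := fun n x => by
    simpa using hf1 n x
  have hsq : ∀ n, Integrable (fun x => (f n x : ℝ) * f n x) μ := fun n =>
    (hi n).bdd_mul (hf n).coe_nnreal_real.aestronglyMeasurable (ae_of_all _ (hb n))
  have hsqT : ∀ n, Integrable (fun x => (f n (T x) : ℝ) * f n (T x)) μ := fun n =>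
    hT.integrable_comp_of_integrable (hsq n)
  have hcross : ∀ n, Integrable (fun x => (f n x : ℝ) * f (n + 1) (T x)) μ := fun n =>
    (hi n).mul_bdd (c := 1) ((hf _).comp hT.measurable).coe_nnreal_real.aestronglyMeasurable
      (ae_of_all _ fun x => hb _ _)
  have hexp : ∀ n, (fun x => ((f n x : ℝ) - f (n + 1) (T x)) ^ 2) = fun x =>
      (f n x : ℝ) * f n x - 2 * ((f n x : ℝ) * f (n + 1) (T x)) +
        (f (n + 1) (T x) : ℝ) * f (n + 1) (T x) := fun n => by
    ext x; ring
  have hint : ∀ n, Integrable (fun x => ((f n x : ℝ) - f (n + 1) (T x)) ^ 2) μ := fun n => by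
    rw [hexp]
    exact ((hsq n).sub ((hcross n).const_mul 2)).add (hsqT (n + 1))
  -- The cross term, by duality, and the last square, by invariance, both equal the energy of `f (n
  -- + 1)`.
  have hval : ∀ n, ∫ x, ((f n x : ℝ) - f (n + 1) (T x)) ^ 2 ∂μ =
      ∫ x, (f n x : ℝ) * f n x ∂μ - ∫ x, (f (n + 1) x : ℝ) * f (n + 1) x ∂μ := fun n => by
    have h1 : ∫ x, (f n x : ℝ) * f (n + 1) (T x) ∂μ =
        ∫ x, (f (n + 1) x : ℝ) * f (n + 1) x ∂μ :=
      integral_comp_smul_of_map_withDensity (k := fun x => (f (n + 1) x : ℝ)) hT.measurable (hf n)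
        (hf (n + 1)) (hmap n) (hf (n + 1)).coe_nnreal_real.aestronglyMeasurable
    have h2 : ∫ x, (f (n + 1) (T x) : ℝ) * f (n + 1) (T x) ∂μ =
        ∫ x, (f (n + 1) x : ℝ) * f (n + 1) x ∂μ := by
      have := integral_map (μ := μ) hT.measurable.aemeasurable
        (f := fun x => (f (n + 1) x : ℝ) * f (n + 1) x)
        (by rw [hT.map_eq]; exact (hsq (n + 1)).aestronglyMeasurable)
      rw [hT.map_eq] at this
      exact this.symm
    have hsub : Integrable (fun x => (f n x : ℝ) * f n x -
        2 * ((f n x : ℝ) * f (n + 1) (T x))) μ := (hsq n).sub ((hcross n).const_mul 2)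
    rw [hexp, integral_add hsub (hsqT (n + 1)),
      integral_sub (hsq n) ((hcross n).const_mul 2), integral_const_mul, h1, h2]
    ring
  refine ⟨hint, ?_⟩
  have hanti : Antitone fun n => ∫ x, (f n x : ℝ) * f n x ∂μ := antitone_nat_of_succ_le fun n => by
    have : 0 ≤ ∫ x, ((f n x : ℝ) - f (n + 1) (T x)) ^ 2 ∂μ :=
      integral_nonneg fun x => sq_nonneg _
    rw [hval] at this
    linarith
  have hlim := tendsto_atTop_ciInf hanti ⟨0, by
    rintro _ ⟨n, rfl⟩
    exact integral_nonneg fun x => mul_self_nonneg _⟩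
  simp only [hval]
  simpa using hlim.sub (hlim.comp (tendsto_add_atTop_nat 1))

/-- Chebyshev: otherwise the integral would be at least `δ² μ(A)`. One good point in `A` is enough
later, as monotonicity spreads the estimate. -/
theorem eventually_exists_lt_of_tendsto_integral_sq {g : ℕ → X → ℝ}
    (hg : ∀ n, Integrable (fun x => g n x ^ 2) μ)
    (hlim : Tendsto (fun n => ∫ x, g n x ^ 2 ∂μ) atTop (𝓝 0)) {A : Set X} (hA : MeasurableSet A)
    (hA0 : μ A ≠ 0) (hA1 : μ A ≠ ∞) {δ : ℝ} (hδ : 0 < δ) :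
    ∀ᶠ n in atTop, ∃ x ∈ A, |g n x| < δ := by
  have hpos : 0 < δ ^ 2 * μ.real A := mul_pos (pow_pos hδ 2) (ENNReal.toReal_pos hA0 hA1)
  filter_upwards [hlim.eventually (gt_mem_nhds hpos)] with n hn
  by_contra! h
  refine absurd hn (not_lt.2 ?_)
  calc δ ^ 2 * μ.real A = ∫ _ in A, δ ^ 2 ∂μ := by
        rw [setIntegral_const, smul_eq_mul, mul_comm]
    _ ≤ ∫ x in A, g n x ^ 2 ∂μ := by
        refine setIntegral_mono_on (integrableOn_const hA1) (hg n).integrableOn hA fun x hx => ?_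
        rw [← sq_abs (g n x)]
        exact pow_le_pow_left₀ hδ.le (h x hx) 2
    _ ≤ ∫ x, g n x ^ 2 ∂μ :=
        setIntegral_le_integral (hg n) (ae_of_all _ fun x => sq_nonneg _)

end Energy

/-! ### Pointwise decay of the densities -/

theorem Antitone.mul_le_lintegral {f : HalfLine → ℝ≥0} (hf : Antitone f) (x : HalfLine) :
    (f x : ℝ≥0∞) * ENNReal.ofReal x ≤ ∫⁻ y, f y ∂leb := by
  rw [← leb_setOf_le, ← setLIntegral_const]
  refine le_trans ?_ (setLIntegral_le_lintegral {y : HalfLine | (y : ℝ) ≤ x} _)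
  exact setLIntegral_mono' (measurableSet_setOf_coe_le _) fun y hy =>
    ENNReal.coe_le_coe.2 (hf (Subtype.coe_le_coe.1 hy))

theorem Antitone.coe_le_div {f : HalfLine → ℝ≥0} (hf : Antitone f) {b : ℝ} (hb : 0 ≤ b)
    (hfb : ∫⁻ y, f y ∂leb = ENNReal.ofReal b) (x : HalfLine) : (f x : ℝ) ≤ b / x := by
  have hx : (0 : ℝ) < x := x.2
  have h := hf.mul_le_lintegral x
  rw [hfb, ← ENNReal.ofReal_coe_nnreal, ← ENNReal.ofReal_mul (f x).coe_nonneg,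
    ENNReal.ofReal_le_ofReal_iff hb] at h
  rwa [le_div_iff₀ hx]

section Branches

variable {T : HalfLine → HalfLine} {P : HalfLinePartition} {τ : ℕ → ℝ → ℝ} {D : ℕ → Set ℝ}

/-- With a single branch, `T` would be increasing with `T y < y`, and the preimage of `(0, T y]`
would be the longer `(0, y]`, against invariance. -/
theorem one_mem_index (hfull : HasFullBranches T P τ D)
    (hindiff : HasIndifferentFixedPointAtInfty P τ) (hpres : MeasurePreserving T leb leb)
    (hconv : HasIncreasingConvexBranches P τ D) : 1 ∈ P.index := by
  by_contra h
  have hN : P.numBranches = (1 : ℕ) := le_antisymm (not_lt.1 h) P.one_le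
  have ha : P.a 1 = 0 := P.last_eq_zero 1 hN
  have hmem : ∀ y : HalfLine, y ∈ P.halfPiece 0 := fun y => by
    simp [halfPiece, piece, ha]
  have hmono := hfull.strictMonoOn hindiff hconv zero_mem_index
  let y : HalfLine := ⟨1, mem_Ioi.2 one_pos⟩
  have hpre : T ⁻¹' {z : HalfLine | (z : ℝ) ≤ T y} = {z : HalfLine | (z : ℝ) ≤ y} := by
    ext z
    exact hmono.le_iff_le (hmem z) (hmem y)
  have h1 := hpres.measure_preimage (measurableSet_setOf_coe_le (T y : ℝ)).nullMeasurableSet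
  rw [hpre, leb_setOf_le, leb_setOf_le, 
    ENNReal.ofReal_eq_ofReal_iff (mem_Ioi.1 y.2).le (mem_Ioi.1 (T y).2).le] at h1
  have h2 := (hfull 0 zero_mem_index).2.2.1 y (hmem y)
  have h3 := hindiff.1 y (by rw [ha]; exact (mem_Ioi.1 y.2).le)
  linarith

theorem tendsto_antitone_density_zero (hfull : HasFullBranches T P τ D)
    (hindiff : HasIndifferentFixedPointAtInfty P τ) (hpres : MeasurePreserving T leb leb)
    (hconv : HasIncreasingConvexBranches P τ D) {f : ℕ → HalfLine → ℝ≥0}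
    (hf : ∀ n, Antitone (f n)) (hf1 : ∀ n x, f n x ≤ 1) {b : ℝ} (hb : 0 < b)
    (hfb : ∀ n, ∫⁻ x, f n x ∂leb = ENNReal.ofReal b)
    (hmap : ∀ n, (leb.withDensity fun x => (f n x : ℝ≥0∞)).map T =
      leb.withDensity fun x => (f (n + 1) x : ℝ≥0∞)) (y : HalfLine) :
    Tendsto (fun n => (f n y : ℝ)) atTop (𝓝 0) := by
  have hE := tendsto_integral_sq_sub_comp hpres (fun n => (hf n).measurable) hf1
    (fun n => by rw [hfb]; exact ENNReal.ofReal_ne_top) hmap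
  have h1i := one_mem_index hfull hindiff hpres hconv
  have ha2 : 0 ≤ P.a 2 := a_nonneg (by norm_num) (succ_le_of_mem_index h1i)
  have ha1 : 0 < P.a 1 := ha2.trans_lt (P.decreasing 1 le_rfl (succ_le_of_mem_index h1i))
  have hclose : ∀ {A : Set HalfLine} {c d : ℝ}, A.OrdConnected → leb A = ENNReal.ofReal (d - c) →
      c < d → ∀ {δ : ℝ}, 0 < δ → ∀ᶠ n in atTop, ∃ x ∈ A, |(f n x : ℝ) - f (n + 1) (T x)| < δ := by
    intro A c d hA hm hcd δ hδ
    refine eventually_exists_lt_of_tendsto_integral_sq hE.1 hE.2 hA.measurableSet ?_ ?_ hδ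
    · rw [hm]; simpa using hcd
    · rw [hm]; exact ENNReal.ofReal_ne_top
  have hstep : ∀ ε > 0, ∀ᶠ n in atTop, (f n ⟨P.a 1, ha1⟩ : ℝ) < ε := by
    intro ε hε
    have hM : 0 < 2 * b / ε := by positivity
    -- Between `p` and `a 1` the image exceeds `2b/ε`, where the tail bound `b / x` is at most
    -- `ε/2`.
    obtain ⟨p, hp, hpM⟩ := (hfull 1 h1i).1.surjOn (mem_univ (⟨2 * b / ε, hM⟩ : HalfLine))
    have hpa := lt_of_mem_halfPiece le_rfl hp
    have hmono := hfull.strictMonoOn hindiff hconv h1i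
    filter_upwards [hclose (A := {x : HalfLine | (p : ℝ) < x ∧ (x : ℝ) < P.a 1})
      ⟨fun x hx z hz w hw => ⟨hx.1.trans_le hw.1, lt_of_le_of_lt hw.2 hz.2⟩⟩
      (leb_setOf_lt_lt (le_of_lt p.2) _) hpa (half_pos hε)] with n hn
    obtain ⟨x, ⟨hpx, hxa⟩, hx⟩ := hn
    have hx1 : x ∈ P.halfPiece 1 := by
      have h2 : P.a 2 < x := (a_succ_lt_of_mem_halfPiece hp).trans hpx
      simp only [halfPiece, piece, one_ne_zero, if_false]
      exact ⟨h2, hxa⟩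
    have hTx : T p < T x := hmono hp hx1 hpx
    have h1 : (f (n + 1) (T x) : ℝ) ≤ ε / 2 := by
      refine (NNReal.coe_le_coe.2 (hf (n + 1) hTx.le)).trans ?_
      refine ((hf (n + 1)).coe_le_div hb.le (hfb _) _).trans (le_of_eq ?_)
      rw [hpM]
      field_simp
    have h2 : (f n ⟨P.a 1, ha1⟩ : ℝ) ≤ f n x :=
      NNReal.coe_le_coe.2 (hf n (Subtype.coe_le_coe.1 hxa.le))
    have h3 := (abs_lt.1 hx).2
    linarith
  -- On `(a 1, z]` the image lies below `y`, so `f (n+1) y ≤ f (n+1) (T x) ≈ f n x ≤ f n (a 1)`;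
  -- hence the index shift.
  obtain ⟨z, hz, hzy⟩ := (hfull 0 zero_mem_index).1.surjOn (mem_univ y)
  have hza : P.a 1 < z := a_succ_lt_of_mem_halfPiece hz
  have hmono := hfull.strictMonoOn hindiff hconv zero_mem_index
  rw [← tendsto_add_atTop_iff_nat 1]
  refine tendsto_order.2 ⟨fun c hc => Eventually.of_forall fun n => hc.trans_le (f _ y).2,
    fun ε hε => ?_⟩
  filter_upwards [hstep (ε / 2) (half_pos hε),
    hclose (A := {x : HalfLine | P.a 1 < (x : ℝ) ∧ (x : ℝ) ≤ z})
      ⟨fun x hx z hz w hw => ⟨hx.1.trans_le hw.1, le_trans hw.2 hz.2⟩⟩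
      (leb_setOf_lt_le ha1.le _) hza (half_pos hε)] with n hn1 hn2
  obtain ⟨x, ⟨hax, hxz⟩, hx⟩ := hn2
  have hx0 : x ∈ P.halfPiece 0 := by simpa [halfPiece, piece] using hax
  have h1 : T x ≤ y := hzy ▸ hmono.monotoneOn hx0 hz hxz
  have h2 : (f (n + 1) y : ℝ) ≤ f (n + 1) (T x) := NNReal.coe_le_coe.2 (hf _ h1)
  have h3 : (f n x : ℝ) ≤ f n ⟨P.a 1, ha1⟩ :=
    NNReal.coe_le_coe.2 (hf n (Subtype.coe_le_coe.1 hax.le))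
  have h4 := (abs_lt.1 hx).1
  linarith

/-- The densities of the push-forwards of Lebesgue measure on `(0, b]` are antitone and tend to
zero. -/
theorem exists_antitone_density_iterate (hfull : HasFullBranches T P τ D)
    (hindiff : HasIndifferentFixedPointAtInfty P τ) (hpres : MeasurePreserving T leb leb)
    (hconv : HasIncreasingConvexBranches P τ D) {b : ℝ} (hb : 0 < b) :
    ∃ f : ℕ → HalfLine → ℝ≥0, (∀ n, Antitone (f n)) ∧ (∀ n x, f n x ≤ 1) ∧
      (∀ n, ∫⁻ x, f n x ∂leb = ENNReal.ofReal b) ∧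
      (∀ n, (leb.restrict {x : HalfLine | (x : ℝ) ≤ b}).map T^[n] =
        leb.withDensity fun x => (f n x : ℝ≥0∞)) ∧
      ∀ y, Tendsto (fun n => (f n y : ℝ)) atTop (𝓝 0) := by
  -- Bundling the invariants makes the chosen successor a self-map that can be iterated.
  let Good : Type := {f : HalfLine → ℝ≥0 // Antitone f ∧ (∀ x, f x ≤ 1) ∧
    ∫⁻ x, f x ∂leb = ENNReal.ofReal b}
  have hnext : ∀ f : Good, ∃ h : Good, (leb.withDensity fun x => (f.1 x : ℝ≥0∞)).map T =
      leb.withDensity fun x => (h.1 x : ℝ≥0∞) := by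
    rintro ⟨f, hf, hf1, hfb⟩
    obtain ⟨h, hh, hh1, hmap⟩ := exists_antitone_map_density hfull hindiff hpres hconv hf hf1
      (by rw [hfb]; exact ENNReal.ofReal_ne_top)
    refine ⟨⟨h, hh, hh1, ?_⟩, hmap⟩
    have := congrArg (fun μ : Measure HalfLine => μ univ) hmap
    simp only [Measure.map_apply hpres.measurable MeasurableSet.univ, preimage_univ,
      withDensity_apply _ MeasurableSet.univ, Measure.restrict_univ] at this
    rw [← this, hfb]
  choose next hnext using hnext
  let f₀ : Good := ⟨{x : HalfLine | (x : ℝ) ≤ b}.indicator 1, by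
      intro x y hxy
      by_cases hy : (y : ℝ) ≤ b
      · have hx : (x : ℝ) ≤ b := le_trans (Subtype.coe_le_coe.2 hxy) hy
        simp [indicator, hx, hy]
      · simp [indicator, hy], fun x => by
      by_cases hx : (x : ℝ) ≤ b <;> simp [indicator, hx], by
      simp only [ENNReal.coe_indicator, Pi.one_apply, ENNReal.coe_one]
      rw [lintegral_indicator (measurableSet_setOf_coe_le b)]
      simp [leb_setOf_le]⟩
  let f : ℕ → Good := fun n => next^[n] f₀
  have hmap : ∀ n, (leb.withDensity fun x => ((f n).1 x : ℝ≥0∞)).map T =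
      leb.withDensity fun x => ((f (n + 1)).1 x : ℝ≥0∞) := fun n => by
    rw [hnext (f n)]
    simp only [f, Function.iterate_succ_apply']
  refine ⟨fun n => (f n).1, fun n => (f n).2.1, fun n => (f n).2.2.1, fun n => (f n).2.2.2,
    fun n => ?_, tendsto_antitone_density_zero hfull hindiff hpres hconv (fun n => (f n).2.1)
    (fun n => (f n).2.2.1) hb (fun n => (f n).2.2.2) hmap⟩
  induction n with
  | zero =>
    rw [Function.iterate_zero, Measure.map_id, ← withDensity_indicator_one
      (measurableSet_setOf_coe_le b)]
    congr 1
    ext x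
    by_cases hx : (x : ℝ) ≤ b <;> simp [f, f₀, indicator, hx]
  | succ n ih =>
    rw [Function.iterate_succ', ← Measure.map_map hpres.measurable
      (hpres.measurable.iterate n), ih, hmap]

end Branches

/-! ### Averaging a global observable against antitone densities -/

/-- If the integrals of `k` over initial segments are controlled by a measure `ρ`, then so are its
integrals against antitone densities. -/
theorem norm_integral_smul_le_of_isLowerSet {k : HalfLine → ℂ} (hk : AEStronglyMeasurable k leb)
    {C : ℝ} (hC : ∀ᵐ x ∂leb, ‖k x‖ ≤ C) {ρ : Measure HalfLine}
    (hρ : ∀ S : Set HalfLine, IsLowerSet S → leb S ≠ ∞ → ‖∫ x in S, k x ∂leb‖ ≤ ρ.real S)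
    {f : HalfLine → ℝ≥0} (hf : Antitone f) (hfin : ∫⁻ x, f x ∂leb ≠ ∞)
    (hfρ : ∫⁻ x, f x ∂ρ ≠ ∞) : ‖∫ x, f x • k x ∂leb‖ ≤ ∫ x, (f x : ℝ) ∂ρ := by
  have hfm : Measurable fun x => (f x : ℝ) := hf.measurable.coe_nnreal_real
  have hfi : Integrable (fun x => (f x : ℝ)) leb := integrable_coe_nnreal hf.measurable hfin
  have hfiρ : Integrable (fun x => (f x : ℝ)) ρ := integrable_coe_nnreal hf.measurable hfρ
  -- Its integral over `t > 0` is `f x • k x`; Fubini then leaves integrals of `k` over the lower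
  -- sets `{t < f}`.
  set φ : HalfLine → ℝ → ℂ := fun x t => (Iio (f x : ℝ)).indicator (fun _ => k x) t with hφ
  have hinner : ∀ {E : Type} [NormedAddCommGroup E] [NormedSpace ℝ E] [CompleteSpace E]
      (x : HalfLine) (c : E),
      ∫ t in Ioi (0 : ℝ), (Iio (f x : ℝ)).indicator (fun _ => c) t = (f x : ℝ) • c := by
    intro E _ _ _ x c
    rw [setIntegral_indicator measurableSet_Iio, setIntegral_const, Ioi_inter_Iio,
      Measure.real, Real.volume_Ioo, sub_zero, ENNReal.toReal_ofReal (f x).coe_nonneg]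
  have hmeas : AEStronglyMeasurable (Function.uncurry φ)
      (leb.prod (volume.restrict (Ioi (0 : ℝ)))) := by
    have : Function.uncurry φ = {p : HalfLine × ℝ | p.2 < (f p.1 : ℝ)}.indicator
        fun p => k p.1 := by
      ext ⟨x, t⟩
      simp [Function.uncurry, hφ, indicator]
    rw [this]
    exact (hk.comp_fst).indicator (measurableSet_lt measurable_snd (hfm.comp measurable_fst))
  have hint : Integrable (Function.uncurry φ) (leb.prod (volume.restrict (Ioi (0 : ℝ)))) := by
    rw [integrable_prod_iff hmeas]
    constructor
    · refine ae_of_all _ fun x => ?_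
      simp only [Function.uncurry, hφ]
      rw [integrable_indicator_iff measurableSet_Iio, IntegrableOn,
        Measure.restrict_restrict measurableSet_Iio]
      refine integrableOn_const ?_
      rw [Iio_inter_Ioi, Real.volume_Ioo]
      exact ENNReal.ofReal_ne_top
    · have : (fun x => ∫ t in Ioi (0 : ℝ), ‖Function.uncurry φ (x, t)‖) =
          fun x => (f x : ℝ) * ‖k x‖ := by
        ext x
        simp only [Function.uncurry, hφ, norm_indicator_eq_indicator_norm]
        exact hinner x ‖k x‖
      rw [this]
      exact hfi.mul_bdd hk.norm (by simpa using hC)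
  have hswap : ∫ x, f x • k x ∂leb = ∫ t in Ioi (0 : ℝ), ∫ x in {x | t < f x}, k x ∂leb := by
    calc ∫ x, f x • k x ∂leb = ∫ x, (∫ t in Ioi (0 : ℝ), φ x t) ∂leb := by
          refine integral_congr_ae (ae_of_all _ fun x => ?_)
          exact (hinner x (k x)).symm
      _ = ∫ t in Ioi (0 : ℝ), (∫ x, φ x t ∂leb) := integral_integral_swap hint
      _ = _ := by
          refine integral_congr_ae (ae_of_all _ fun t => ?_)
          simp only
          rw [← integral_indicator (measurableSet_lt measurable_const hfm)]
          rfl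
  rw [hswap, hfiρ.integral_eq_integral_meas_lt (ae_of_all _ fun x => (f x).coe_nonneg)]
  refine norm_integral_le_of_norm_le ?_ ?_
  · refine integrable_toReal_of_lintegral_ne_top ?_ ?_
    · refine (Antitone.measurable (f := fun t : ℝ => ρ {x | t < (f x : ℝ)}) ?_).aemeasurable
      exact fun s t hst => measure_mono fun x hx => lt_of_le_of_lt hst hx
    · rw [← lintegral_eq_lintegral_meas_lt ρ (ae_of_all _ fun x => (f x).coe_nonneg) hfm.aemeasurable]
      simpa using hfρ
  · filter_upwards [ae_restrict_mem measurableSet_Ioi] with t ht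
    exact hρ _ (fun x y hxy hx => lt_of_lt_of_le hx (NNReal.coe_le_coe.2 (hf hxy)))
      (hfi.measure_gt_lt_top ht).ne

/-- Up to a null set `S` is some `(0, ℓ]`: the mean of `F` over it is within `ε` of `L` if `ℓ ≥ A`,
and the trivial bound `C ℓ` serves if `ℓ < A`. Stating this as a measure of `S` allows integration
over superlevel sets. -/
theorem HasInfiniteVolumeAverage.exists_bound {F : HalfLine → ℂ} {L : ℂ}
    (hF : AEStronglyMeasurable F leb) {C : ℝ≥0} (hC : ∀ᵐ x ∂leb, ‖F x - L‖ ≤ C)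
    (h : HasInfiniteVolumeAverage F L) {ε : ℝ≥0} (hε : 0 < ε) :
    ∃ A : ℝ, ∀ S : Set HalfLine, IsLowerSet S → leb S ≠ ∞ →
      ‖∫ x in S, (F x - L) ∂leb‖ ≤
        (ε • leb + C • leb.restrict {x : HalfLine | (x : ℝ) ≤ A}).real S := by
  obtain ⟨A, hA'⟩ := ((eventually_gt_atTop (0 : ℝ)).and
    (h.eventually (Metric.closedBall_mem_nhds L (NNReal.coe_pos.2 hε)))).exists_forall_of_atTop
  have hA1 : 0 < A := (hA' A le_rfl).1
  have hA := fun a ha => (hA' a ha).2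
  refine ⟨A, fun S hS hfin => ?_⟩
  set ℓ := (leb S).toReal with hℓ
  have hae := hS.ae_eq_setOf_le hfin
  have hℓ0 : 0 ≤ ℓ := ENNReal.toReal_nonneg
  have hfinℓ : leb {x : HalfLine | (x : ℝ) ≤ ℓ} ≠ ∞ := by
    rw [leb_setOf_le]; exact ENNReal.ofReal_ne_top
  have hreal : leb.real {x : HalfLine | (x : ℝ) ≤ ℓ} = ℓ := by
    rw [Measure.real, leb_setOf_le, ENNReal.toReal_ofReal hℓ0]
  have hval : (ε • leb + C • leb.restrict {x : HalfLine | (x : ℝ) ≤ A}).real S =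
      ε * ℓ + C * (leb.restrict {x : HalfLine | (x : ℝ) ≤ A}).real S := by
    have h2 : leb.restrict {x : HalfLine | (x : ℝ) ≤ A} S ≠ ∞ :=
      ((Measure.restrict_apply_le _ _).trans_lt hfin.lt_top).ne
    rw [measureReal_add_apply (ENNReal.mul_ne_top ENNReal.coe_ne_top hfin)
      (ENNReal.mul_ne_top ENNReal.coe_ne_top h2), measureReal_nnreal_smul_apply,
      measureReal_nnreal_smul_apply]
    rfl
  rw [hval, setIntegral_congr_set hae]
  have hk : IntegrableOn (fun x => F x - L) {x : HalfLine | (x : ℝ) ≤ ℓ} leb :=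
    Measure.integrableOn_of_bounded hfinℓ (hF.sub aestronglyMeasurable_const)
      (ae_restrict_of_ae hC)
  rcases le_or_gt A ℓ with hAℓ | hAℓ
  · have hℓpos : 0 < ℓ := hA1.trans_le hAℓ
    have hFi : IntegrableOn F {x : HalfLine | (x : ℝ) ≤ ℓ} leb := by
      simpa [Pi.add_def] using hk.add (integrableOn_const (C := L) hfinℓ)
    have h1 := hA ℓ hAℓ
    rw [dist_eq_norm] at h1
    have h2 : ∫ x in {x : HalfLine | (x : ℝ) ≤ ℓ}, (F x - L) ∂leb =
        (ℓ : ℂ) * ((ℓ : ℂ)⁻¹ * ∫ x in {x : HalfLine | (x : ℝ) ≤ ℓ}, F x ∂leb - L) := by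
      have : (ℓ : ℂ) ≠ 0 := by exact_mod_cast hℓpos.ne'
      rw [integral_sub hFi (integrableOn_const hfinℓ), setIntegral_const, hreal]
      rw [mul_sub, mul_inv_cancel_left₀ this]
      rfl
    rw [h2, norm_mul, Complex.norm_real, Real.norm_of_nonneg hℓ0]
    have h3 : 0 ≤ (C : ℝ) * (leb.restrict {x : HalfLine | (x : ℝ) ≤ A}).real S := by positivity
    nlinarith [mul_le_mul_of_nonneg_left h1 hℓ0]
  · have hsub : {x : HalfLine | (x : ℝ) ≤ ℓ} ∩ {x : HalfLine | (x : ℝ) ≤ A} =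
        {x : HalfLine | (x : ℝ) ≤ ℓ} := inter_eq_left.2 fun x hx => le_trans hx hAℓ.le
    have h1 : (leb.restrict {x : HalfLine | (x : ℝ) ≤ A}).real S = ℓ := by
      rw [Measure.real, Measure.restrict_apply hS.ordConnected.measurableSet,
        measure_congr (hae.inter (ae_eq_refl {x : HalfLine | (x : ℝ) ≤ A})), ← hℓ, hsub]
      exact hreal
    have h2 := norm_setIntegral_le_of_norm_le_const_ae' hfinℓ.lt_top
      (f := fun x => F x - L) (C := C) (hC.mono fun x hx _ => hx)
    rw [hreal] at h2
    rw [h1]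
    have h3 : 0 ≤ (ε : ℝ) * ℓ := by positivity
    linarith

/-- The bound is `ε b + C ∫_(0,A] f n`, whose second term vanishes by dominated convergence on a set
of finite measure. -/
theorem tendsto_integral_smul_antitone {F : HalfLine → ℂ} {L : ℂ}
    (hF : AEStronglyMeasurable F leb) {C : ℝ≥0} (hC : ∀ᵐ x ∂leb, ‖F x - L‖ ≤ C)
    (h : HasInfiniteVolumeAverage F L) {f : ℕ → HalfLine → ℝ≥0} (hf : ∀ n, Antitone (f n))
    (hf1 : ∀ n x, f n x ≤ 1) {b : ℝ} (hb : 0 ≤ b)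
    (hfb : ∀ n, ∫⁻ x, f n x ∂leb = ENNReal.ofReal b)
    (hlim : ∀ y, Tendsto (fun n => (f n y : ℝ)) atTop (𝓝 0)) :
    Tendsto (fun n => ∫ x, f n x • (F x - L) ∂leb) atTop (𝓝 0) := by
  have hfi : ∀ n, Integrable (fun x => (f n x : ℝ)) leb := fun n =>
    integrable_coe_nnreal (hf n).measurable (by rw [hfb]; exact ENNReal.ofReal_ne_top)
  have hfbI : ∀ n, ∫ x, (f n x : ℝ) ∂leb = b := fun n => by
    rw [integral_eq_lintegral_of_nonneg_ae (ae_of_all _ fun x => (f n x).coe_nonneg)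
      (hfi n).aestronglyMeasurable]
    simp only [ENNReal.ofReal_coe_nnreal]
    rw [hfb, ENNReal.toReal_ofReal hb]
  rw [tendsto_zero_iff_norm_tendsto_zero]
  refine tendsto_order.2 ⟨fun c hc => Eventually.of_forall fun n => hc.trans_le (norm_nonneg _),
    fun η hη => ?_⟩
  -- The denominator uses `b + 1` since `b` may be 0.
  obtain ⟨ε, hε, hεb⟩ : ∃ ε : ℝ≥0, 0 < ε ∧ (ε : ℝ) * b < η / 2 := by
    refine ⟨⟨η / (2 * (b + 1)), by positivity⟩, ?_, ?_⟩
    · exact NNReal.coe_pos.1 (show 0 < η / (2 * (b + 1)) by positivity)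
    · change η / (2 * (b + 1)) * b < η / 2
      rw [div_mul_eq_mul_div, div_lt_div_iff₀ (by positivity) (by positivity)]
      nlinarith
  obtain ⟨A, hA⟩ := h.exists_bound hF hC hε
  have hfinA : leb {x : HalfLine | (x : ℝ) ≤ A} ≠ ∞ := by
    rw [leb_setOf_le]; exact ENNReal.ofReal_ne_top
  have hA0 : Tendsto (fun n => (C : ℝ) * ∫ x in {x : HalfLine | (x : ℝ) ≤ A}, (f n x : ℝ) ∂leb)
      atTop (𝓝 0) := by
    have := tendsto_integral_of_dominated_convergence
      (μ := leb.restrict {x : HalfLine | (x : ℝ) ≤ A}) (F := fun n x => (f n x : ℝ))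
      (f := fun _ => (0 : ℝ)) (fun _ => (1 : ℝ))
      (fun n => ((hf n).measurable.coe_nnreal_real).aestronglyMeasurable)
      (integrableOn_const hfinA) (fun n => ae_of_all _ fun x => by simpa using hf1 n x)
      (ae_of_all _ hlim)
    simpa using this.const_mul (C : ℝ)
  filter_upwards [hA0.eventually (gt_mem_nhds (half_pos hη))] with n hn
  have hfA : IntegrableOn (fun x => (f n x : ℝ)) {x : HalfLine | (x : ℝ) ≤ A} leb :=
    (hfi n).integrableOn
  have hle := norm_integral_smul_le_of_isLowerSet (hF.sub aestronglyMeasurable_const) hC hA (hf n)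
    (by rw [hfb]; exact ENNReal.ofReal_ne_top) (by
      rw [lintegral_add_measure, lintegral_smul_measure, lintegral_smul_measure, hfb]
      refine ENNReal.add_ne_top.2 ⟨?_, ?_⟩
      · exact ENNReal.mul_ne_top ENNReal.coe_ne_top ENNReal.ofReal_ne_top
      · refine ENNReal.mul_ne_top ENNReal.coe_ne_top (ne_top_of_le_ne_top ?_
          (setLIntegral_le_lintegral _ _))
        rw [hfb]; exact ENNReal.ofReal_ne_top)
  rw [integral_add_measure ((hfi n).smul_measure_nnreal) (hfA.smul_measure_nnreal),
    integral_smul_nnreal_measure, integral_smul_nnreal_measure, hfbI] at hle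
  simp only [NNReal.smul_def, smul_eq_mul] at hle
  linarith!

/-! ### From initial segments to integrable functions -/

section Density

variable {k : ℕ → HalfLine → ℂ} {C : ℝ}

/-- Dominated convergence for series, with majorant `C * leb (s i)`, summable because the union has
finite measure. -/
theorem tendsto_setIntegral_iUnion_zero (hk : ∀ n, AEStronglyMeasurable (k n) leb)
    (hC : ∀ n, ∀ᵐ x ∂leb, ‖k n x‖ ≤ C) {s : ℕ → Set HalfLine} (hs : ∀ i, MeasurableSet (s i))
    (hd : Pairwise (Function.onFun Disjoint s)) (hfin : leb (⋃ i, s i) ≠ ∞)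
    (h : ∀ i, Tendsto (fun n => ∫ x in s i, k n x ∂leb) atTop (𝓝 0)) :
    Tendsto (fun n => ∫ x in ⋃ i, s i, k n x ∂leb) atTop (𝓝 0) := by
  have hfi : ∀ i, leb (s i) ≠ ∞ := fun i => ne_top_of_le_ne_top hfin
    (measure_mono (subset_iUnion s i))
  have heq : ∀ n, ∫ x in ⋃ i, s i, k n x ∂leb = ∑' i, ∫ x in s i, k n x ∂leb := fun n =>
    integral_iUnion hs hd (Measure.integrableOn_of_bounded hfin (hk n)
      (ae_restrict_of_ae (hC n)))
  simp only [heq]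
  have hsum : Summable fun i => C * leb.real (s i) := by
    refine Summable.mul_left _ (ENNReal.summable_toReal ?_)
    rwa [← measure_iUnion hd hs]
  have := tendsto_tsum_of_dominated_convergence (f := fun n i => ∫ x in s i, k n x ∂leb)
    (g := fun _ => (0 : ℂ)) hsum h (Eventually.of_forall fun n i =>
      norm_setIntegral_le_of_norm_le_const_ae' (hfi i).lt_top
        ((hC n).mono fun x hx _ => hx))
  simpa using this

/-- Initial segments form a generating π-system, which settles sets inside a bounded window; a set
of finite measure is then sliced into unit strips. -/
theorem tendsto_setIntegral_zero (hk : ∀ n, AEStronglyMeasurable (k n) leb)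
    (hC : ∀ n, ∀ᵐ x ∂leb, ‖k n x‖ ≤ C)
    (h : ∀ b > 0, Tendsto (fun n => ∫ x in {x : HalfLine | (x : ℝ) ≤ b}, k n x ∂leb) atTop (𝓝 0))
    {s : Set HalfLine} (hs : MeasurableSet s) (hfin : leb s ≠ ∞) :
    Tendsto (fun n => ∫ x in s, k n x ∂leb) atTop (𝓝 0) := by
  have hint : ∀ n {t : Set HalfLine}, leb t ≠ ∞ → IntegrableOn (k n) t leb := fun n t ht =>
    Measure.integrableOn_of_bounded ht (hk n) (ae_restrict_of_ae (hC n))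
  have hbdd : ∀ b > 0, ∀ t, MeasurableSet t →
      Tendsto (fun n => ∫ x in t ∩ {x : HalfLine | (x : ℝ) ≤ b}, k n x ∂leb) atTop (𝓝 0) := by
    intro b hb
    have hI := measurableSet_setOf_coe_le b
    have hbfin : leb {x : HalfLine | (x : ℝ) ≤ b} ≠ ∞ := by
      rw [leb_setOf_le]; exact ENNReal.ofReal_ne_top
    refine MeasurableSpace.induction_on_inter
      ((BorelSpace.measurable_eq (α := HalfLine)).trans (borel_eq_generateFrom_Iic HalfLine))
      isPiSystem_Iic ?_ ?_ ?_ ?_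
    · simp
    · rintro _ ⟨a, rfl⟩
      have : Iic a ∩ {x : HalfLine | (x : ℝ) ≤ b} = {x : HalfLine | (x : ℝ) ≤ min (a : ℝ) b} := by
        ext x
        simp [← Subtype.coe_le_coe]
      rw [this]
      exact h _ (lt_min a.2 hb)
    · intro t ht hlim
      have heq : ∀ n, ∫ x in tᶜ ∩ {x : HalfLine | (x : ℝ) ≤ b}, k n x ∂leb =
          ∫ x in {x : HalfLine | (x : ℝ) ≤ b}, k n x ∂leb -
            ∫ x in t ∩ {x : HalfLine | (x : ℝ) ≤ b}, k n x ∂leb := fun n => by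
        rw [← integral_inter_add_sdiff ht (hint n hbfin), inter_comm, ← sdiff_eq, inter_comm t]
        ring
      simp only [heq]
      simpa using (h b hb).sub hlim
    · intro f hd hfm hlim
      rw [iUnion_inter]
      refine tendsto_setIntegral_iUnion_zero hk hC (fun i => (hfm i).inter hI)
        (fun i j hij => (hd hij).mono inter_subset_left inter_subset_left) ?_ hlim
      rw [← iUnion_inter]
      exact ne_top_of_le_ne_top hbfin (measure_mono inter_subset_right)
  have hcover : s = ⋃ m : ℕ, (s ∩ {x : HalfLine | (m : ℝ) < x}) ∩
      {x : HalfLine | (x : ℝ) ≤ m + 1} := by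
    ext x
    simp only [mem_iUnion, mem_inter_iff, mem_ofPred_eq]
    refine ⟨fun hx => ?_, fun ⟨m, hm⟩ => hm.1.1⟩
    -- Positivity of `x` makes the ceiling positive, so the truncated subtraction is exact.
    refine ⟨⌈(x : ℝ)⌉₊ - 1, ?_⟩
    have hx0 : 0 < ⌈(x : ℝ)⌉₊ := Nat.ceil_pos.2 x.2
    have h1 := Nat.le_ceil (x : ℝ)
    have h2 := Nat.ceil_lt_add_one (mem_Ioi.1 x.2).le
    rw [Nat.cast_sub hx0, Nat.cast_one]
    exact ⟨⟨hx, by linarith⟩, by linarith⟩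
  have hmm : ∀ m : ℕ, MeasurableSet (s ∩ {x : HalfLine | (m : ℝ) < x}) := fun m =>
    hs.inter (measurable_subtype_coe measurableSet_Ioi)
  rw [hcover]
  refine tendsto_setIntegral_iUnion_zero hk hC
    (fun m => (hmm m).inter (measurableSet_setOf_coe_le _)) ?_ (by rwa [← hcover])
    (fun m => hbdd _ (by positivity) _ (hmm m))
  intro i j hij
  refine disjoint_left.2 ?_
  rintro x ⟨⟨-, hi⟩, hi'⟩ ⟨⟨-, hj⟩, hj'⟩
  simp only [mem_ofPred_eq] at hi hi' hj hj'
  have h1 : (i : ℝ) < j + 1 := by linarith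
  have h2 : (j : ℝ) < i + 1 := by linarith
  norm_cast at h1 h2
  omega

/-- A bounded sequence of functions that tends to zero in mean on every initial segment tends to
zero weakly against integrable functions. -/
theorem tendsto_integral_mul_zero (hk : ∀ n, AEStronglyMeasurable (k n) leb)
    (hC : ∀ n, ∀ᵐ x ∂leb, ‖k n x‖ ≤ C)
    (h : ∀ b > 0, Tendsto (fun n => ∫ x in {x : HalfLine | (x : ℝ) ≤ b}, k n x ∂leb) atTop (𝓝 0))
    {g : HalfLine → ℂ} (hg : Integrable g leb) :
    Tendsto (fun n => ∫ x, k n x * g x ∂leb) atTop (𝓝 0) := by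
  have hC0 : 0 ≤ C := by
    by_contra hneg
    have h0 : ∀ᵐ x ∂leb, False := (hC 0).mono fun x hx => hneg ((norm_nonneg _).trans hx)
    have h1 : leb {x : HalfLine | (x : ℝ) ≤ 1} = 0 := by
      rw [ae_iff] at h0
      exact measure_mono_null (fun x _ => id) h0
    simp [leb_setOf_le] at h1
  have hint : ∀ n {g : HalfLine → ℂ}, Integrable g leb → Integrable (fun x => k n x * g x) leb :=
    fun n g hg => hg.bdd_mul (hk n) (hC n)
  refine Integrable.induction
    (fun g => Tendsto (fun n => ∫ x, k n x * g x ∂leb) atTop (𝓝 0)) ?_ ?_ ?_ ?_ hg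
  · intro c s hs hfin
    have heq : ∀ n, ∫ x, k n x * s.indicator (fun _ => c) x ∂leb = (∫ x in s, k n x ∂leb) * c := by
      intro n
      rw [← integral_mul_const, ← integral_indicator hs]
      congr 1
      ext x
      by_cases hx : x ∈ s <;> simp [hx]
    simp only [heq]
    simpa using (tendsto_setIntegral_zero hk hC h hs hfin.ne).mul_const c
  · intro f g _ hf hg hf0 hg0
    have heq : ∀ n, ∫ x, k n x * (f + g) x ∂leb =
        ∫ x, k n x * f x ∂leb + ∫ x, k n x * g x ∂leb := fun n => by
      rw [← integral_add (hint n hf) (hint n hg)]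
      simp only [Pi.add_apply, mul_add]
    simp only [heq]
    simpa using hf0.add hg0
  -- The uniform bound `C` makes the functionals equicontinuous on `L¹`, so the limit 0 passes to
  -- the closure.
  · refine isClosed_of_closure_subset fun f hf => ?_
    change Tendsto (fun n => ∫ x, k n x * f x ∂leb) atTop (𝓝 0)
    rw [Metric.tendsto_atTop]
    intro ε hε
    obtain ⟨g, hg, hfg⟩ := Metric.mem_closure_iff.1 hf (ε / (2 * (C + 1))) (by positivity)
    obtain ⟨N, hN⟩ := Metric.tendsto_atTop.1 hg (ε / 2) (half_pos hε)
    refine ⟨N, fun n hn => ?_⟩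
    have h1 := hN n hn
    rw [dist_zero_right] at h1 ⊢
    have hfi := L1.integrable_coeFn f
    have hgi := L1.integrable_coeFn g
    have h2 : ∫ x, k n x * f x ∂leb - ∫ x, k n x * g x ∂leb = ∫ x, k n x * (f x - g x) ∂leb := by
      rw [← integral_sub (hint n hfi) (hint n hgi)]
      simp only [mul_sub]
    have h3 : ‖∫ x, k n x * (f x - g x) ∂leb‖ ≤ C * dist f g := by
      rw [dist_eq_norm, L1.norm_eq_integral_norm, ← integral_const_mul]
      refine norm_integral_le_of_norm_le ((L1.integrable_coeFn (f - g)).norm.const_mul C) ?_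
      filter_upwards [hC n, Lp.coeFn_sub f g] with x hx hsub
      rw [hsub, norm_mul, Pi.sub_apply]
      exact mul_le_mul_of_nonneg_right hx (norm_nonneg _)
    have h4 : C * dist f g ≤ ε / 2 := by
      rw [lt_div_iff₀ (by positivity)] at hfg
      nlinarith [dist_nonneg (x := f) (y := g)]
    calc ‖∫ x, k n x * f x ∂leb‖
        = ‖(∫ x, k n x * f x ∂leb - ∫ x, k n x * g x ∂leb) + ∫ x, k n x * g x ∂leb‖ := by
          rw [sub_add_cancel]
      _ ≤ ‖∫ x, k n x * f x ∂leb - ∫ x, k n x * g x ∂leb‖ + ‖∫ x, k n x * g x ∂leb‖ :=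
          norm_add_le _ _
      _ < ε := by rw [h2]; linarith
  · intro f g hfg _ hf
    have heq : ∀ n, ∫ x, k n x * g x ∂leb = ∫ x, k n x * f x ∂leb := fun n =>
      integral_congr_ae (hfg.mono fun x hx => by simp only [hx])
    simpa only [heq] using hf

end Density

/-! ### Global-local mixing -/

theorem theorem2p7 (T : HalfLine → HalfLine) (P : HalfLinePartition)
    (τ : ℕ → ℝ → ℝ) (D : ℕ → Set ℝ)
    (hfull : HasFullBranches T P τ D)
    (hexp : IsExpandingOffZeroBranch P τ D)
    (hdist : HasBoundedDistortionRatio P τ D)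
    (hindiff : HasIndifferentFixedPointAtInfty P τ)
    (hpres : MeasurePreserving T leb leb)
    (hconv : HasIncreasingConvexBranches P τ D) :
    IsGLM2 T := by
  intro F L hF hL g hg
  have hTn : ∀ n, MeasurePreserving T^[n] leb leb := hpres.iterate
  obtain ⟨C, hC⟩ : ∃ C : ℝ≥0, ∀ᵐ x ∂leb, ‖F x - L‖ ≤ C := by
    have htop : eLpNormEssSup F leb ≠ ∞ := by
      have := hF.2.ne
      rwa [eLpNorm_exponent_top] at this
    refine ⟨(eLpNormEssSup F leb).toNNReal + ‖L‖₊, ?_⟩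
    filter_upwards [ae_le_eLpNormEssSup (f := F) (μ := leb)] with x hx
    have h1 : ‖F x‖₊ ≤ (eLpNormEssSup F leb).toNNReal := by
      rw [← ENNReal.coe_le_coe, ENNReal.coe_toNNReal htop]
      exact hx
    have h2 : ‖F x - L‖ ≤ ‖F x‖ + ‖L‖ := norm_sub_le _ _
    have h3 : ‖F x‖ ≤ ((eLpNormEssSup F leb).toNNReal : ℝ) := by exact_mod_cast h1
    push_cast
    exact h2.trans (add_le_add h3 le_rfl)
  have hFm := hF.aestronglyMeasurable
  have hkm : ∀ n, AEStronglyMeasurable (fun x => F (T^[n] x) - L) leb := fun n =>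
    (hFm.comp_measurePreserving (hTn n)).sub aestronglyMeasurable_const
  have hkC : ∀ n, ∀ᵐ x ∂leb, ‖F (T^[n] x) - L‖ ≤ C := fun n =>
    (hTn n).quasiMeasurePreserving.ae hC
  -- Pushing forward by `T^[n]` moves the dynamics from `F` onto the density.
  have hmain : ∀ b > 0, Tendsto (fun n => ∫ x in {x : HalfLine | (x : ℝ) ≤ b},
      (F (T^[n] x) - L) ∂leb) atTop (𝓝 0) := by
    intro b hb
    obtain ⟨f, hf, hf1, hfb, hmap, hlim⟩ :=
      exists_antitone_density_iterate hfull hindiff hpres hconv hb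
    have heq : ∀ n, ∫ x in {x : HalfLine | (x : ℝ) ≤ b}, (F (T^[n] x) - L) ∂leb =
        ∫ x, f n x • (F x - L) ∂leb := fun n => by
      rw [← integral_withDensity_eq_integral_smul (hf n).measurable, ← hmap n,
        integral_map (hTn n).measurable.aemeasurable]
      rw [hmap n]
      exact (hFm.sub aestronglyMeasurable_const).mono_ac (withDensity_absolutelyContinuous _ _)
    simp only [heq]
    exact tendsto_integral_smul_antitone hFm hC hL hf hf1 hb.le hfb hlim
  have h0 := tendsto_integral_mul_zero hkm hkC hmain hg
  have heq : ∀ n, ∫ x, F (T^[n] x) * g x ∂leb =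
      ∫ x, (F (T^[n] x) - L) * g x ∂leb + L * ∫ x, g x ∂leb := fun n => by
    rw [← integral_const_mul, ← integral_add (hg.bdd_mul (hkm n) (hkC n)) (hg.const_mul L)]
    congr 1
    ext x
    ring
  simp only [heq]
  simpa using h0.add_const (L * ∫ x, g x ∂leb)
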